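/- Let $n\ge 1$. Let $\mathcal{RH}_\infty$ be the set of proper real-rational functions of $s$ with all poles in the open left half plane; a real-rational matrix is called stable if all its entries lie in $\mathcal{RH}_\infty$. A value at $s=j\omega$ with $\omega=\pm\infty$ means the limit as $|s|\to\infty$, and $\angle c\in(-\pi,\pi]$ is the principal argument of $c\in\mathbb C$. A matrix $A\in\mathbb{C}^{n\times n}$ is sectorial if $x^*Ax\neq 0$ for all $x\in\mathbb C^n$ with $\|x\|=1$. Then $A=T^*DT$ with $T$ nonsingular and $D=\mathrm{diag}(e^{j\phi_1},\dots,e^{j\phi_n})$, where the reals $\phi_k$ (the phases of $A$, with maximum $\bar\phi(A)$ and minimum $\underline\phi(A)$) are chosen so that $\bar\phi(A)-\underline\phi(A)<\pi$ and $\tfrac12(\bar\phi(A)+\underline\phi(A))\in(-\pi,\pi]$; they are unique up to order. Let $\bar\sigma(A)$ be the largest singular value of $A$, and set $$\mathcal P(\alpha,\beta)=\{A\in\mathbb{C}^{n\times n} \text{ sectorial}:\ \underline\phi(A)>\alpha,\ \bar\phi(A)<\beta\},\qquad \bar{\mathcal P}(\alpha,\beta)=\{A\in\mathbb{C}^{n\times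 n} \text{ sectorial}:\ \underline\phi(A)\ge\alpha,\ \bar\phi(A)\le\beta\},$$ $$\mathcal G(\gamma)=\{A\in\mathbb{C}^{n\times n}:\ \bar\sigma(A)<\gamma\},\qquad \bar{\mathcal G}(\gamma)=\{A\in\mathbb{C}^{n\times n}:\ \bar\sigma(A)\le\gamma\}.$$ For $n\times n$ real-rational matrices $P,C$, the feedback system $P\,\#\,C$ is stable if $I+CP$ is invertible as a real-rational matrix and $$\begin{bmatrix}I\\P\end{bmatrix}(I+CP)^{-1}\begin{bmatrix}I&C\end{bmatrix}\in\mathcal{RH}_\infty^{2n\times 2n}.$$ Theorem (a small vase theorem with necessity). Let $C\in\mathcal{RH}_\infty^{n\times n}$ be such that $C(j\omega)$ is sectorial for every $\omega\in[-\infty,\infty]$. Let $g,h$ be nonzero scalar functions with $g,g^{-1},h,h^{-1}\in\mathcal{RH}_\infty$, and suppose $\angle h(j\omega)\in(-\pi/2,\pi/2)$ for every $\omega\in[-\infty,\infty]$. Then $P\,\#\,C$ is stable for all $P\in\mathcal{RH}_\infty^{n\times n}$ satisfying $$P(j\omega)\in\bar{\mathcal P}\big(-\tfrac{\pi}{2}+\angle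 h(j\omega),\ \tfrac{\pi}{2}+\angle h(j\omega)\big)\cup\bar{\mathcal G}\big(|g(j\omega)|\big)\quad\text{for all }\omega\in[0,\infty]$$ if and only if $$C(j\omega)\in\mathcal P\big(-\tfrac{\pi}{2}-\angle h(j\omega),\ \tfrac{\pi}{2}-\angle h(j\omega)\big)\cap\mathcal G\big(|g(j\omega)|^{-1}\big)\quad\text{for all }\omega\in[0,\infty].$$ -/

import Mathlib

open scoped Matrix

/-- A real-rational scalar transfer function is in `RH∞`: it is proper and every complex pole lies
in the open left half plane. (`RatFunc.num` and `RatFunc.denom` are coprime, so the poles are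
exactly the complex roots of the denominator.) -/
def RHInf : Set (RatFunc ℝ) :=
  {f | f.num.natDegree ≤ f.denom.natDegree ∧
    ∀ s : ℂ, Polynomial.aeval s f.denom = 0 → s.re < 0}

/-- `f` and `f⁻¹` are both in `RH∞` (nonzero, so that `f⁻¹` is a genuine inverse). -/
def IsRHInfUnit (f : RatFunc ℝ) : Prop :=
  f ≠ 0 ∧ f ∈ RHInf ∧ f⁻¹ ∈ RHInf

/-- The value `f(jω)` of a proper transfer function at an extended frequency `ω ∈ [-∞, ∞]`.
At `ω = ±∞` it is the limit of `f(s)` as `|s| → ∞`, that is, the coefficient of the numerator in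
degree `deg (denom f)` divided by the leading coefficient of the denominator. -/
noncomputable def freqValue (f : RatFunc ℝ) (ω : EReal) : ℂ :=
  if ω = ⊤ ∨ ω = ⊥ then
    ((f.num.coeff f.denom.natDegree / f.denom.leadingCoeff : ℝ) : ℂ)
  else
    Polynomial.aeval (Complex.I * (ω.toReal : ℂ)) f.num /
      Polynomial.aeval (Complex.I * (ω.toReal : ℂ)) f.denom

/-- A transfer matrix is stable when all its entries are in `RH∞`. -/
def IsStableTM {m n : Type*} (G : Matrix m n (RatFunc ℝ)) : Prop :=
  ∀ i j, G i j ∈ RHInf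

/-- The frequency response `G(jω)`, `ω ∈ [-∞, ∞]`. -/
noncomputable def freqResponse {m n : Type*} (G : Matrix m n (RatFunc ℝ)) (ω : EReal) :
    Matrix m n ℂ :=
  G.map (fun f => freqValue f ω)

/-- The Gang of Four matrix `P # C = [I; P] (I + C P)⁻¹ [I  C]`. -/
noncomputable def gangOfFour {n : ℕ} (P C : Matrix (Fin n) (Fin n) (RatFunc ℝ)) :
    Matrix (Fin n ⊕ Fin n) (Fin n ⊕ Fin n) (RatFunc ℝ) :=
  Matrix.fromRows 1 P * (1 + C * P)⁻¹ * Matrix.fromCols 1 C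

/-- The feedback interconnection of `P` and `C` is stable: `I + C P` is invertible as a matrix of
rational functions and the Gang of Four matrix is in `RH∞`. -/
def FeedbackStable {n : ℕ} (P C : Matrix (Fin n) (Fin n) (RatFunc ℝ)) : Prop :=
  IsUnit (1 + C * P) ∧ IsStableTM (gangOfFour P C)

/-- The numerical range `{x* A x : ‖x‖ = 1}` (Euclidean norm). -/
def numericalRange {n : ℕ} (A : Matrix (Fin n) (Fin n) ℂ) : Set ℂ :=
  {z | ∃ x : EuclideanSpace ℂ (Fin n), ‖x‖ = 1 ∧ star x.ofLp ⬝ᵥ (A *ᵥ x.ofLp) = z}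

/-- A matrix is sectorial when its numerical range does not contain `0`. -/
def IsSectorial {n : ℕ} (A : Matrix (Fin n) (Fin n) ℂ) : Prop :=
  (0 : ℂ) ∉ numericalRange A

/-- `φ` is a listing, in any order, of the phases of `A`: there is a sectorial decomposition
`A = T* D T`, with `T` nonsingular and `D = diag (exp (j φ₁), …, exp (j φₙ))` diagonal unitary, such
that the phase spread is less than `π` and the phase center lies in `(-π, π]`. For `n ≥ 1` a
sectorial matrix has such a listing, unique up to a permutation. -/
def IsPhases {n : ℕ} (A : Matrix (Fin n) (Fin n) ℂ) (φ : Fin n → ℝ) : Prop :=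
  (∃ T : Matrix (Fin n) (Fin n) ℂ, IsUnit T ∧
    A = Tᴴ * Matrix.diagonal (fun k => Complex.exp (Complex.I * (φ k : ℂ))) * T) ∧
  (⨆ k, φ k) - (⨅ k, φ k) < Real.pi ∧
  ((⨆ k, φ k) + (⨅ k, φ k)) / 2 ∈ Set.Ioc (-Real.pi) Real.pi

/-- `P(α, β)`: sectorial matrices whose smallest phase is `> α` and largest phase is `< β`. -/
def phaseSetOpen (n : ℕ) (α β : ℝ) : Set (Matrix (Fin n) (Fin n) ℂ) :=
  {A | IsSectorial A ∧ ∃ φ : Fin n → ℝ, IsPhases A φ ∧ α < (⨅ k, φ k) ∧ (⨆ k, φ k) < β}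

/-- `P̄(α, β)`: sectorial matrices whose smallest phase is `≥ α` and largest phase is `≤ β`. -/
def phaseSetClosed (n : ℕ) (α β : ℝ) : Set (Matrix (Fin n) (Fin n) ℂ) :=
  {A | IsSectorial A ∧ ∃ φ : Fin n → ℝ, IsPhases A φ ∧ α ≤ (⨅ k, φ k) ∧ (⨆ k, φ k) ≤ β}

/-- The largest singular value, as the operator norm for the Euclidean norm. -/
noncomputable def maxSingularValue {n : ℕ} (A : Matrix (Fin n) (Fin n) ℂ) : ℝ :=
  ‖Matrix.toEuclideanCLM (n := Fin n) (𝕜 := ℂ) A‖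

/-- `G(γ)`: matrices with largest singular value `< γ`. -/
def gainSetOpen (n : ℕ) (γ : ℝ) : Set (Matrix (Fin n) (Fin n) ℂ) :=
  {A | maxSingularValue A < γ}

/-- `Ḡ(γ)`: matrices with largest singular value `≤ γ`. -/
def gainSetClosed (n : ℕ) (γ : ℝ) : Set (Matrix (Fin n) (Fin n) ℂ) :=
  {A | maxSingularValue A ≤ γ}

/-! The Cayley map `s = (1 + z) / (1 - z)` turns the closed right half plane with `∞` into the
closed unit disk. Stable transfer functions form a ring, each point of the disk gives a ring
homomorphism to `ℂ`, and an element that vanishes nowhere on the disk is a unit. Hence, for stable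
`P` and `C`, feedback stability means that `det (1 + C P)` has no zero in the closed disk
(`feedbackStable_iff`).

Sufficiency. On the circle `det (1 + τ C P) ≠ 0` for all `τ ∈ [0, 1]`
(`det_one_add_smul_mul_ne_zero`): a kernel vector would contradict either the signs of the rotated
quadratic forms or submultiplicativity of the norm. The determinant is `1` at `τ = 0`, and zeros
cannot enter the disk without crossing the circle (`ne_zero_of_homotopy`).

Necessity. If the condition fails at one point `z₀` of the circle, an admissible `P` is built for
which `1 + C P` is singular at `z₀`. For the gain, take `x` with `‖x‖ ≤ |g| ‖C x‖` and let the rank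
one matrix `P(z₀)` send `C x` to `-x`. For the phase, put `A = h(z₀) C(z₀)` and take `x` with `Re
x*Ax ≤ 0` and `y = A x`; what is needed is `P = h Q` with `Q` accretive and `Q y = -x`. With `w = (y
- x) / 2` and `w' = (y + x) / 2`, the rank one matrix `S = w' w* / ‖w‖²` is a contraction because
`‖w'‖² - ‖w‖² = Re x*y ≤ 0`, and `Q = (1 - S)(1 + S)⁻¹` does it.

Both matrices extend to all frequencies by interpolating their vectors with functions of constant
modulus on the circle (`exists_vector_interpolant`); data at a real `z₀` must be real, which
`valueField` tracks. Since `P` must be sectorial everywhere, `S` is damped by a function that peaks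
only at `z₀` and its conjugate (`exists_peak`). At these two points sectoriality of `C` gives `x*y ≠
0`, which keeps the form of `Q` away from zero. -/

/-! ### Homogenized polynomials and the Cayley transform -/

section ProjectiveEvaluation

open Polynomial

/-- Evaluation of a real polynomial, homogenized in degree `n`, at a point `(a, b)`. -/
noncomputable def projEval (a b : ℂ) (n : ℕ) (p : ℝ[X]) : ℂ :=
  MvPolynomial.aeval ![a, b] (p.homogenize n)

lemma projEval_add (a b : ℂ) (n : ℕ) (p q : ℝ[X]) :
    projEval a b n (p + q) = projEval a b n p + projEval a b n q := by
  simp [projEval]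

lemma projEval_mul (a b : ℂ) {m n : ℕ} {p q : ℝ[X]} (hp : p.natDegree ≤ m)
    (hq : q.natDegree ≤ n) :
    projEval a b (m + n) (p * q) = projEval a b m p * projEval a b n q := by
  simp [projEval, homogenize_mul p q hp hq]

lemma projEval_of_ne_zero (a : ℂ) {b : ℂ} (hb : b ≠ 0) {n : ℕ} {p : ℝ[X]}
    (hp : p.natDegree ≤ n) : projEval a b n p = b ^ n * aeval (a / b) p := by
  refine induction_with_natDegree_le
    (fun p ↦ projEval a b n p = b ^ n * aeval (a / b) p) n ?_ ?_ ?_ p hp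
  · simp [projEval]
  · intro k r _ hk
    have : b ^ n = b ^ k * b ^ (n - k) := by rw [← pow_add, Nat.add_sub_cancel' hk]
    simp only [projEval, homogenize_C_mul, homogenize_X_pow hk, map_mul, map_pow,
      MvPolynomial.aeval_C, MvPolynomial.aeval_X, aeval_C, aeval_X, this, div_pow]
    simp
    field_simp
  · intro p q _ _ hp hq
    rw [projEval_add, hp, hq, map_add, mul_add]

lemma projEval_zero_right (a : ℂ) {n : ℕ} {p : ℝ[X]} (hp : p.natDegree ≤ n) :
    projEval a 0 n p = p.coeff n * a ^ n := by
  refine induction_with_natDegree_le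
    (fun p ↦ projEval a 0 n p = p.coeff n * a ^ n) n ?_ ?_ ?_ p hp
  · simp [projEval]
  · intro k r _ hk
    simp only [projEval, homogenize_C_mul, homogenize_X_pow hk, map_mul, map_pow,
      MvPolynomial.aeval_C, MvPolynomial.aeval_X]
    rcases hk.eq_or_lt with rfl | hlt
    · simp
    · simp [coeff_X_pow, hlt.ne', (Nat.sub_pos_of_lt hlt).ne']
  · intro p q _ _ hp hq
    rw [projEval_add, hp, hq, coeff_add, Complex.ofReal_add, add_mul]

lemma projEval_conj (a b : ℂ) (n : ℕ) (p : ℝ[X]) :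
    projEval (starRingEnd ℂ a) (starRingEnd ℂ b) n p = starRingEnd ℂ (projEval a b n p) := by
  simp [projEval, homogenize, map_sum, MvPolynomial.aeval_monomial, Finsupp.prod_fintype]

lemma differentiable_projEval (n : ℕ) (p : ℝ[X]) :
    Differentiable ℂ fun z : ℂ ↦ projEval (1 + z) (1 - z) n p := by
  simp only [projEval, homogenize, map_sum, MvPolynomial.aeval_monomial]
  refine Differentiable.fun_sum fun i _ ↦ ?_
  simp only [Finsupp.prod_fintype, Fin.prod_univ_two, pow_zero, implies_true]
  simp
  fun_prop

lemma re_cayley_nonneg {z : ℂ} (hz : ‖z‖ ≤ 1) : 0 ≤ ((1 + z) / (1 - z)).re := by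
  have h : z.re * z.re + z.im * z.im ≤ 1 := by
    rw [← Complex.normSq_apply, Complex.normSq_eq_norm_sq]
    exact pow_le_one₀ (norm_nonneg _) hz
  rw [Complex.div_re, ← add_div]
  refine div_nonneg ?_ (Complex.normSq_nonneg _)
  simp
  nlinarith

lemma projEval_denom_ne_zero {f : RatFunc ℝ} (hf : f ∈ RHInf) {z : ℂ} (hz : ‖z‖ ≤ 1) :
    projEval (1 + z) (1 - z) f.denom.natDegree f.denom ≠ 0 := by
  rcases eq_or_ne z 1 with rfl | hz1
  · rw [sub_self, projEval_zero_right _ le_rfl, coeff_natDegree, RatFunc.monic_denom]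
    norm_num
  · have hb : 1 - z ≠ 0 := sub_ne_zero.2 hz1.symm
    rw [projEval_of_ne_zero _ hb le_rfl]
    exact mul_ne_zero (pow_ne_zero _ hb)
      fun h ↦ (hf.2 _ h).not_ge (re_cayley_nonneg hz)

/-- The value of a transfer function at `s = (1 + z) / (1 - z)`, with `z = 1` for `s = ∞`. -/
noncomputable def diskValue (z : ℂ) (f : RatFunc ℝ) : ℂ :=
  projEval (1 + z) (1 - z) f.denom.natDegree f.num /
    projEval (1 + z) (1 - z) f.denom.natDegree f.denom

lemma diskValue_eq_div {f : RatFunc ℝ} (hf : f ∈ RHInf) {z : ℂ} (hz : ‖z‖ ≤ 1)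
    {p q : ℝ[X]} {n : ℕ} (hp : p.natDegree ≤ n) (hq : q.natDegree ≤ n)
    (hqz : projEval (1 + z) (1 - z) n q ≠ 0)
    (hfpq : f = algebraMap ℝ[X] (RatFunc ℝ) p / algebraMap ℝ[X] (RatFunc ℝ) q) :
    diskValue z f = projEval (1 + z) (1 - z) n p / projEval (1 + z) (1 - z) n q := by
  have hq0 : q ≠ 0 := by rintro rfl; simp [projEval] at hqz
  have h := (RatFunc.num_mul_eq_mul_denom_iff (x := f) (p := p) hq0).2 hfpq
  rw [diskValue, div_eq_div_iff (projEval_denom_ne_zero hf hz) hqz,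
    ← projEval_mul _ _ hf.1 hq, h, ← projEval_mul _ _ hp le_rfl,
    add_comm n]

/-- Nonvanishing at `z = 1` forces `q` to have degree exactly `n`, which gives properness;
nonvanishing at the other points excludes roots with nonnegative real part. The reduced denominator
divides `q`, so it inherits both. The fraction need not be reduced, which makes closure under sums
and products immediate. -/
lemma mem_RHInf_of_eq_div {f : RatFunc ℝ} {p q : ℝ[X]} {n : ℕ} (hp : p.natDegree ≤ n)
    (hq : q.natDegree ≤ n) (hqz : ∀ z : ℂ, ‖z‖ ≤ 1 → projEval (1 + z) (1 - z) n q ≠ 0)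
    (hfpq : f = algebraMap ℝ[X] (RatFunc ℝ) p / algebraMap ℝ[X] (RatFunc ℝ) q) :
    f ∈ RHInf := by
  have hqn : q.coeff n ≠ 0 := by
    have := hqz 1 (by simp)
    rw [sub_self, projEval_zero_right _ hq] at this
    exact_mod_cast left_ne_zero_of_mul this
  have hq0 : q ≠ 0 := by rintro rfl; simp at hqn
  have hqd : q.natDegree = n := hq.antisymm (le_natDegree_of_ne_zero hqn)
  have h := (RatFunc.num_mul_eq_mul_denom_iff (x := f) (p := p) hq0).2 hfpq
  obtain ⟨r, hr⟩ : f.denom ∣ q := (RatFunc.denom_dvd hq0).2 ⟨p, hfpq⟩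
  have hr0 : r ≠ 0 := by rintro rfl; simp at hr; exact hq0 hr
  have hnum : f.num * r = p := by
    refine mul_right_cancel₀ f.denom_ne_zero ?_
    rw [← h, hr]; ring
  refine ⟨?_, fun s hs ↦ ?_⟩
  · rcases eq_or_ne f.num 0 with h0 | h0
    · simp [h0]
    · have h1 := natDegree_mul h0 hr0
      have h2 := natDegree_mul f.denom_ne_zero hr0
      rw [hnum] at h1
      rw [← hr] at h2
      omega
  · by_contra! hre
    have hs1 : s + 1 ≠ 0 := fun h ↦ by
      have := congrArg Complex.re h
      simp at this
      linarith
    have hz : ‖(s - 1) / (s + 1)‖ ≤ 1 := by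
      rw [norm_div, div_le_one (norm_pos_iff.2 hs1), ← sq_le_sq₀ (norm_nonneg _) (norm_nonneg _),
        ← Complex.normSq_eq_norm_sq, ← Complex.normSq_eq_norm_sq, Complex.normSq_apply,
        Complex.normSq_apply]
      simp
      nlinarith
    have hb : 1 - (s - 1) / (s + 1) = 2 / (s + 1) := by field_simp; ring
    have ha : 1 + (s - 1) / (s + 1) = s * (2 / (s + 1)) := by field_simp; ring
    have hb0 : 2 / (s + 1) ≠ 0 := div_ne_zero two_ne_zero hs1
    refine hqz _ hz ?_
    rw [hb, ha, projEval_of_ne_zero _ hb0 hq, mul_div_cancel_right₀ _ hb0, hr, map_mul, hs]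
    simp

end ProjectiveEvaluation

/-! ### The ring of stable transfer functions and its evaluations on the closed disk -/

section TransferFunctionRing

open Polynomial

lemma ratFunc_add_eq (f g : RatFunc ℝ) : f + g =
    algebraMap ℝ[X] (RatFunc ℝ) (f.num * g.denom + g.num * f.denom) /
      algebraMap ℝ[X] (RatFunc ℝ) (f.denom * g.denom) := by
  conv_lhs => rw [← f.num_div_denom, ← g.num_div_denom]
  have h1 := RatFunc.algebraMap_ne_zero f.denom_ne_zero
  have h2 := RatFunc.algebraMap_ne_zero g.denom_ne_zero
  simp only [map_add, map_mul]
  field_simp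

lemma ratFunc_mul_eq (f g : RatFunc ℝ) : f * g =
    algebraMap ℝ[X] (RatFunc ℝ) (f.num * g.num) /
      algebraMap ℝ[X] (RatFunc ℝ) (f.denom * g.denom) := by
  conv_lhs => rw [← f.num_div_denom, ← g.num_div_denom]
  simp only [map_mul, div_mul_div_comm]

lemma projEval_denom_mul_denom_ne_zero {f g : RatFunc ℝ} (hf : f ∈ RHInf) (hg : g ∈ RHInf)
    {z : ℂ} (hz : ‖z‖ ≤ 1) :
    projEval (1 + z) (1 - z) (f.denom.natDegree + g.denom.natDegree) (f.denom * g.denom) ≠ 0 := by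
  rw [projEval_mul _ _ le_rfl le_rfl]
  exact mul_ne_zero (projEval_denom_ne_zero hf hz) (projEval_denom_ne_zero hg hz)

lemma natDegree_add_num_le {f g : RatFunc ℝ} (hf : f ∈ RHInf) (hg : g ∈ RHInf) :
    (f.num * g.denom + g.num * f.denom).natDegree ≤ f.denom.natDegree + g.denom.natDegree :=
  natDegree_add_le_of_degree_le (natDegree_mul_le_of_le hf.1 le_rfl)
    ((natDegree_mul_le_of_le hg.1 le_rfl).trans_eq (add_comm _ _))

lemma add_mem_RHInf {f g : RatFunc ℝ} (hf : f ∈ RHInf) (hg : g ∈ RHInf) : f + g ∈ RHInf :=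
  mem_RHInf_of_eq_div (natDegree_add_num_le hf hg) natDegree_mul_le
    (fun _ hz ↦ projEval_denom_mul_denom_ne_zero hf hg hz) (ratFunc_add_eq f g)

lemma mul_mem_RHInf {f g : RatFunc ℝ} (hf : f ∈ RHInf) (hg : g ∈ RHInf) : f * g ∈ RHInf :=
  mem_RHInf_of_eq_div (natDegree_mul_le_of_le hf.1 hg.1) natDegree_mul_le
    (fun _ hz ↦ projEval_denom_mul_denom_ne_zero hf hg hz) (ratFunc_mul_eq f g)

lemma C_mem_RHInf (c : ℝ) : RatFunc.C c ∈ RHInf := by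
  simp [RHInf]

lemma diskValue_add {f g : RatFunc ℝ} (hf : f ∈ RHInf) (hg : g ∈ RHInf) {z : ℂ}
    (hz : ‖z‖ ≤ 1) : diskValue z (f + g) = diskValue z f + diskValue z g := by
  have h1 := projEval_denom_ne_zero hf hz
  have h2 := projEval_denom_ne_zero hg hz
  rw [diskValue_eq_div (add_mem_RHInf hf hg) hz (natDegree_add_num_le hf hg) natDegree_mul_le
    (projEval_denom_mul_denom_ne_zero hf hg hz) (ratFunc_add_eq f g), projEval_add,
    projEval_mul _ _ hf.1 le_rfl, add_comm f.denom.natDegree, projEval_mul _ _ hg.1 le_rfl,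
    add_comm g.denom.natDegree, projEval_mul _ _ le_rfl le_rfl, diskValue, diskValue]
  field_simp

lemma diskValue_mul {f g : RatFunc ℝ} (hf : f ∈ RHInf) (hg : g ∈ RHInf) {z : ℂ}
    (hz : ‖z‖ ≤ 1) : diskValue z (f * g) = diskValue z f * diskValue z g := by
  rw [diskValue_eq_div (mul_mem_RHInf hf hg) hz (natDegree_mul_le_of_le hf.1 hg.1) natDegree_mul_le
    (projEval_denom_mul_denom_ne_zero hf hg hz) (ratFunc_mul_eq f g),
    projEval_mul _ _ hf.1 hg.1, projEval_mul _ _ le_rfl le_rfl, diskValue, diskValue,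
    div_mul_div_comm]

lemma diskValue_C (z : ℂ) (c : ℝ) : diskValue z (RatFunc.C c) = c := by
  simp [diskValue, projEval]

/-- The ring of stable proper real-rational transfer functions. -/
def RHInfRing : Subring (RatFunc ℝ) where
  carrier := RHInf
  mul_mem' := mul_mem_RHInf
  one_mem' := by simpa using C_mem_RHInf 1
  add_mem' := add_mem_RHInf
  zero_mem' := by simpa using C_mem_RHInf 0
  neg_mem' {f} hf := by simpa using mul_mem_RHInf (C_mem_RHInf (-1)) hf

/-- Evaluation of stable transfer functions at a point of the closed unit disk. -/
noncomputable def diskEval (z : ℂ) (hz : ‖z‖ ≤ 1) : RHInfRing →+* ℂ where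
  toFun f := diskValue z f
  map_one' := by simpa using diskValue_C z 1
  map_mul' f g := diskValue_mul f.2 g.2 hz
  map_zero' := by simpa using diskValue_C z 0
  map_add' f g := diskValue_add f.2 g.2 hz

lemma diskEval_apply (z : ℂ) (hz : ‖z‖ ≤ 1) (f : RHInfRing) :
    diskEval z hz f = diskValue z f := rfl

/-- The value of `f` is a quotient of homogenizations in one common degree, so its nonvanishing is
the hypothesis of `mem_RHInf_of_eq_div` for the flipped fraction. -/
lemma exists_inverse_of_diskValue_ne_zero (f : RHInfRing)
    (hf : ∀ z : ℂ, ‖z‖ ≤ 1 → diskValue z f ≠ 0) : ∃ g : RHInfRing, f * g = 1 := by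
  have h0 : (f : RatFunc ℝ) ≠ 0 := by
    intro h
    have := hf 0 (by simp)
    rw [h] at this
    exact this (by simpa using diskValue_C 0 0)
  refine ⟨⟨(f : RatFunc ℝ)⁻¹, ?_⟩, Subtype.ext (mul_inv_cancel₀ h0)⟩
  refine mem_RHInf_of_eq_div (p := (f : RatFunc ℝ).denom) (q := (f : RatFunc ℝ).num)
    (n := (f : RatFunc ℝ).denom.natDegree) le_rfl f.2.1 (fun z hz h ↦ hf z hz ?_) ?_
  · rw [diskValue, h, zero_div]
  · rw [← inv_div, RatFunc.num_div_denom]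

lemma diskValue_conj (z : ℂ) (f : RatFunc ℝ) :
    diskValue (starRingEnd ℂ z) f = starRingEnd ℂ (diskValue z f) := by
  have := fun p ↦ projEval_conj (1 + z) (1 - z) f.denom.natDegree p
  simp only [map_add, map_sub, map_one] at this
  rw [diskValue, this, this, diskValue, map_div₀]

lemma continuousOn_diskValue {f : RatFunc ℝ} (hf : f ∈ RHInf) :
    ContinuousOn (fun z ↦ diskValue z f) (Metric.closedBall 0 1) :=
  (differentiable_projEval _ _).continuous.continuousOn.div
    (differentiable_projEval _ _).continuous.continuousOn
    fun _ hz ↦ projEval_denom_ne_zero hf (by simpa using hz)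

lemma differentiableOn_diskValue {f : RatFunc ℝ} (hf : f ∈ RHInf) :
    DifferentiableOn ℂ (fun z ↦ diskValue z f) (Metric.ball 0 1) :=
  (differentiable_projEval _ _).differentiableOn.div
    (differentiable_projEval _ _).differentiableOn
    fun _ hz ↦ projEval_denom_ne_zero hf (by simpa using (Metric.ball_subset_closedBall hz))

lemma diskValue_one {f : RatFunc ℝ} (hf : f ∈ RHInf) {ω : EReal} (hω : ω = ⊤ ∨ ω = ⊥) :
    diskValue 1 f = freqValue f ω := by
  rw [freqValue, if_pos hω, diskValue, sub_self, projEval_zero_right _ hf.1,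
    projEval_zero_right _ le_rfl, mul_div_mul_right _ _ (by norm_num)]
  simp

lemma diskValue_of_ne_one {f : RatFunc ℝ} (hf : f ∈ RHInf) {z : ℂ} (hz : z ≠ 1) {ω : ℝ}
    (hω : (1 + z) / (1 - z) = Complex.I * ω) : diskValue z f = freqValue f ω := by
  have hb : 1 - z ≠ 0 := sub_ne_zero.2 hz.symm
  rw [freqValue, if_neg (by simp), EReal.toReal_coe, ← hω, diskValue,
    projEval_of_ne_zero _ hb hf.1, projEval_of_ne_zero _ hb le_rfl,
    mul_div_mul_left _ _ (pow_ne_zero _ hb)]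

/-- With `exists_frequency`, the dictionary between extended frequencies and the unit circle; both
infinite frequencies correspond to `z = 1`. -/
lemma exists_circle_point (ω : EReal) :
    ∃ z : ℂ, ‖z‖ = 1 ∧ ∀ f ∈ RHInf, freqValue f ω = diskValue z f := by
  by_cases hω : ω = ⊤ ∨ ω = ⊥
  · exact ⟨1, by simp, fun f hf ↦ (diskValue_one hf hω).symm⟩
  · push Not at hω
    lift ω to ℝ using hω
    have h1 : Complex.I * ω + 1 ≠ 0 := fun h ↦ by simpa using congrArg Complex.re h
    refine ⟨(Complex.I * ω - 1) / (Complex.I * ω + 1), ?_, fun f hf ↦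
      (diskValue_of_ne_one hf ?_ ?_).symm⟩
    · rw [norm_div, div_eq_one_iff_eq (norm_ne_zero_iff.2 h1), Complex.norm_def, Complex.norm_def,
        Complex.normSq_apply, Complex.normSq_apply]
      simp
    · rw [ne_eq, div_eq_one_iff_eq h1]
      intro h
      have := congrArg Complex.re h
      simp at this
      norm_num at this
    · have : 1 - (Complex.I * ω - 1) / (Complex.I * ω + 1) ≠ 0 := by
        rw [one_sub_div h1]
        exact div_ne_zero (by ring_nf; norm_num) h1
      field_simp
      ring

lemma exists_frequency {z : ℂ} (hz : ‖z‖ = 1) :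
    ∃ ω : EReal, ∀ f ∈ RHInf, freqValue f ω = diskValue z f := by
  rcases eq_or_ne z 1 with rfl | hz1
  · exact ⟨⊤, fun f hf ↦ (diskValue_one hf (Or.inl rfl)).symm⟩
  · refine ⟨(((1 + z) / (1 - z)).im : ℝ), fun f hf ↦ (diskValue_of_ne_one hf hz1 ?_).symm⟩
    have h : z.re * z.re + z.im * z.im = 1 := by
      rw [← Complex.normSq_apply, Complex.normSq_eq_norm_sq, hz, one_pow]
    apply Complex.ext
    · rw [Complex.div_re, ← add_div]
      simp
      left
      nlinarith
    · simp

lemma freqValue_neg {f : RatFunc ℝ} (ω : EReal) :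
    freqValue f (-ω) = starRingEnd ℂ (freqValue f ω) := by
  have key (p : ℝ[X]) (s : ℂ) : aeval (starRingEnd ℂ s) p = starRingEnd ℂ (aeval s p) :=
    aeval_algHom_apply Complex.conjAe.toAlgHom s p
  have hiff : (-ω = ⊤ ∨ -ω = ⊥) ↔ (ω = ⊤ ∨ ω = ⊥) := by
    rw [EReal.neg_eq_top_iff, EReal.neg_eq_bot_iff, or_comm]
  unfold freqValue
  by_cases h : ω = ⊤ ∨ ω = ⊥
  · rw [if_pos h, if_pos (hiff.2 h), Complex.conj_ofReal]
  · rw [if_neg h, if_neg (fun h' ↦ h (hiff.1 h')), map_div₀, ← key, ← key]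
    simp

end TransferFunctionRing

/-! ### Zeros of a holomorphic homotopy -/

section NonvanishingHomotopy

open Metric Set

/-- The maximum modulus principle for `1 / f`. -/
lemma le_norm_of_le_norm_on_circle {f : ℂ → ℂ} (hc : ContinuousOn f (closedBall 0 1))
    (hd : DifferentiableOn ℂ f (ball 0 1)) (hf : ∀ z, ‖z‖ ≤ 1 → f z ≠ 0) {c : ℝ} (hc0 : 0 < c)
    (hb : ∀ z, ‖z‖ = 1 → c ≤ ‖f z‖) {z : ℂ} (hz : ‖z‖ ≤ 1) : c ≤ ‖f z‖ := by
  have hdiff : DiffContOnCl ℂ (fun z ↦ (f z)⁻¹) (ball 0 1) := by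
    refine ⟨hd.inv fun w hw ↦ hf w (by simpa using ball_subset_closedBall hw), ?_⟩
    rw [closure_ball _ one_ne_zero]
    exact hc.inv₀ fun w hw ↦ hf w (by simpa using hw)
  have h := Complex.norm_le_of_forall_mem_frontier_norm_le isBounded_ball hdiff (C := c⁻¹)
    (z := z) ?_ ?_
  · rw [norm_inv] at h
    exact (inv_le_inv₀ (norm_pos_iff.2 (hf z hz)) hc0).1 h
  · rw [frontier_ball _ one_ne_zero]
    intro w hw
    rw [norm_inv]
    exact inv_anti₀ hc0 (hb w (by simpa using hw))
  · rw [closure_ball _ one_ne_zero]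
    simpa using hz

/-- If a homotopy of functions holomorphic in the disk never vanishes on the circle and starts from
a function without zeros in the closed disk, then it ends at one. -/
lemma ne_zero_of_homotopy {F : ℝ → ℂ → ℂ}
    (hF : ContinuousOn (Function.uncurry F) (Icc 0 1 ×ˢ closedBall 0 1))
    (hd : ∀ τ ∈ Icc (0 : ℝ) 1, DifferentiableOn ℂ (F τ) (ball 0 1))
    (hb : ∀ τ ∈ Icc (0 : ℝ) 1, ∀ z, ‖z‖ = 1 → F τ z ≠ 0)
    (h0 : ∀ z, ‖z‖ ≤ 1 → F 0 z ≠ 0) {z : ℂ} (hz : ‖z‖ ≤ 1) : F 1 z ≠ 0 := by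
  obtain ⟨c, hc0, hc⟩ : ∃ c : ℝ, 0 < c ∧
      ∀ τ ∈ Icc (0 : ℝ) 1, ∀ z, ‖z‖ = 1 → c ≤ ‖F τ z‖ := by
    have hK : IsCompact (Icc (0 : ℝ) 1 ×ˢ sphere (0 : ℂ) 1) :=
      isCompact_Icc.prod (isCompact_sphere _ _)
    obtain ⟨p, hp, hmin⟩ := hK.exists_isMinOn ⟨(0, 1), by simp⟩
      ((hF.mono (prod_mono_right sphere_subset_closedBall)).norm)
    exact ⟨‖F p.1 p.2‖, norm_pos_iff.2 (hb _ hp.1 _ (by simpa using hp.2)),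
      fun τ hτ z hz ↦ hmin (show (τ, z) ∈ _ from ⟨hτ, by simpa using hz⟩)⟩
  have hunif := (isCompact_Icc.prod (isCompact_closedBall (0 : ℂ) 1)).uniformContinuousOn_of_continuous
    hF
  obtain ⟨δ, hδ, hclose⟩ := Metric.uniformContinuousOn_iff.1 hunif c hc0
  obtain ⟨N, hN⟩ := exists_nat_one_div_lt hδ
  have hN0 : (0 : ℝ) < N + 1 := by positivity
  have hmem (k : ℕ) (hk : k ≤ N + 1) : (k : ℝ) / (N + 1) ∈ Icc (0 : ℝ) 1 :=
    ⟨by positivity, (div_le_one hN0).2 (by exact_mod_cast hk)⟩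
  -- If one time slice has no zeros, its modulus is at least `c` throughout the disk; the next slice
  -- differs from it by less than `c`, so it has no zeros either.
  have key (k : ℕ) (hk : k ≤ N + 1) : ∀ z, ‖z‖ ≤ 1 → F ((k : ℝ) / (N + 1)) z ≠ 0 := by
    induction k with
    | zero => simpa using h0
    | succ k ih =>
      intro z hz hzero
      have hk' : k ≤ N + 1 := by omega
      have hcont : ContinuousOn (F ((k : ℝ) / (N + 1))) (closedBall 0 1) :=
        hF.comp (f := fun z ↦ ((k : ℝ) / (N + 1), z)) (by fun_prop) fun w hw ↦ ⟨hmem k hk', hw⟩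
      have h1 := le_norm_of_le_norm_on_circle hcont (hd _ (hmem k hk')) (ih hk') hc0
        (hc _ (hmem k hk')) hz
      have h2 := hclose ((k : ℝ) / (N + 1), z) ⟨hmem k hk', by simpa using hz⟩
        (((k + 1 : ℕ) : ℝ) / (N + 1), z) ⟨hmem _ hk, by simpa using hz⟩ (by
          rw [Prod.dist_eq, dist_self, max_eq_left dist_nonneg, Real.dist_eq, ← sub_div]
          have : (k : ℝ) - ((k + 1 : ℕ) : ℝ) = -1 := by push_cast; ring
          rw [this, abs_div, abs_neg, abs_one, abs_of_pos hN0]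
          exact hN)
      simp only [Function.uncurry_apply_pair, hzero, dist_zero_right] at h2
      linarith
  have := key (N + 1) le_rfl z hz
  rwa [show ((N + 1 : ℕ) : ℝ) / (N + 1) = 1 by push_cast; exact div_self hN0.ne'] at this

end NonvanishingHomotopy

/-! ### Phases described by quadratic forms -/

section Phases

open Matrix
open scoped ComplexOrder MatrixOrder

lemma isSectorial_iff {n : ℕ} {A : Matrix (Fin n) (Fin n) ℂ} :
    IsSectorial A ↔ ∀ x : Fin n → ℂ, x ≠ 0 → star x ⬝ᵥ (A *ᵥ x) ≠ 0 := by
  constructor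
  · intro h x hx h0
    have hx' : WithLp.toLp 2 x ≠ 0 := by simpa using hx
    refine h ⟨((‖WithLp.toLp 2 x‖⁻¹ : ℝ) : ℂ) • WithLp.toLp 2 x, ?_, ?_⟩
    · rw [norm_smul]
      simp [norm_ne_zero_iff.2 hx']
    · simp [mulVec_smul, h0]
  · rintro h ⟨x, hx, h0⟩
    exact h x.ofLp (fun h' ↦ by
      have : x = 0 := by ext i; simp [h']
      simp [this] at hx) h0

lemma form_conjTranspose_diagonal {n : ℕ} (T : Matrix (Fin n) (Fin n) ℂ) (d : Fin n → ℂ)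
    (x : Fin n → ℂ) : star x ⬝ᵥ ((Tᴴ * diagonal d * T) *ᵥ x) =
      ∑ k, ((‖(T *ᵥ x) k‖ ^ 2 : ℝ) : ℂ) * d k := by
  rw [← mulVec_mulVec, ← mulVec_mulVec, dotProduct_mulVec, ← star_mulVec, dotProduct]
  refine Finset.sum_congr rfl fun k _ ↦ ?_
  rw [mulVec_diagonal, Pi.star_apply, mul_left_comm, mul_comm, RCLike.star_def,
    ← Complex.normSq_eq_conj_mul_self, Complex.normSq_eq_norm_sq]

lemma re_exp_mul_form {n : ℕ} (T : Matrix (Fin n) (Fin n) ℂ) (φ : Fin n → ℝ) (θ : ℝ)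
    (x : Fin n → ℂ) :
    (Complex.exp (Complex.I * θ) * (star x ⬝ᵥ
      ((Tᴴ * diagonal (fun k ↦ Complex.exp (Complex.I * (φ k : ℂ))) * T) *ᵥ x))).re =
      ∑ k, ‖(T *ᵥ x) k‖ ^ 2 * Real.cos (φ k + θ) := by
  rw [form_conjTranspose_diagonal, Finset.mul_sum, Complex.re_sum]
  refine Finset.sum_congr rfl fun k _ ↦ ?_
  rw [mul_left_comm, ← Complex.exp_add, Complex.re_ofReal_mul, ← mul_add, ← Complex.ofReal_add,
    mul_comm Complex.I, Complex.exp_ofReal_mul_I_re, add_comm θ]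

/-- A matrix with positive definite Hermitian part is congruent to a diagonal matrix whose diagonal
entries have real part one. -/
lemma exists_congruence_of_accretive {n : ℕ} {B : Matrix (Fin n) (Fin n) ℂ}
    (hB : ∀ x : Fin n → ℂ, x ≠ 0 → 0 < (star x ⬝ᵥ (B *ᵥ x)).re) :
    ∃ (V : Matrix (Fin n) (Fin n) ℂ) (l : Fin n → ℝ), IsUnit V ∧
      B = Vᴴ * diagonal (fun k ↦ 1 + Complex.I * (l k : ℂ)) * V := by
  set H : Matrix (Fin n) (Fin n) ℂ := (1 / 2 : ℂ) • (B + Bᴴ) with hH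
  set K : Matrix (Fin n) (Fin n) ℂ := (-Complex.I / 2) • (B - Bᴴ) with hK
  have hBHK : B = H + Complex.I • K := by
    rw [hH, hK, smul_smul, show Complex.I * (-Complex.I / 2) = 1 / 2 by
      rw [← mul_div_assoc, mul_neg, Complex.I_mul_I, neg_neg], ← smul_add, add_add_sub_cancel,
      ← two_smul ℂ B, smul_smul]
    norm_num
  have hHherm : H.IsHermitian := by
    rw [IsHermitian, hH, conjTranspose_smul, conjTranspose_add, conjTranspose_conjTranspose,
      add_comm]
    simp
  have hKherm : K.IsHermitian := by
    rw [IsHermitian, hK, conjTranspose_smul, conjTranspose_sub, conjTranspose_conjTranspose,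
      ← neg_sub B, smul_neg, ← neg_smul]
    congr 1
    simp [neg_div]
  have hHpos : H.PosDef := by
    refine PosDef.of_dotProduct_mulVec_pos hHherm fun x hx ↦ ?_
    have h1 : star x ⬝ᵥ (Bᴴ *ᵥ x) = star (star x ⬝ᵥ (B *ᵥ x)) := by
      rw [dotProduct_mulVec, ← star_mulVec, star_dotProduct]
    have h2 : star x ⬝ᵥ (H *ᵥ x) = ((star x ⬝ᵥ (B *ᵥ x)).re : ℂ) := by
      rw [hH, smul_mulVec, add_mulVec, dotProduct_smul, dotProduct_add, h1, RCLike.star_def,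
        Complex.add_conj]
      simp
    rw [h2]
    exact_mod_cast hB x hx
  obtain ⟨S, hS, hHS⟩ : ∃ S : Matrix (Fin n) (Fin n) ℂ, IsUnit S ∧ H = Sᴴ * S := by
    obtain ⟨S, hS⟩ := CStarAlgebra.nonneg_iff_eq_star_mul_self.1 hHpos.posSemidef.nonneg
    rw [star_eq_conjTranspose] at hS
    refine ⟨S, ?_, hS⟩
    have := hHpos.isUnit
    rw [hS, isUnit_iff_isUnit_det, det_mul] at this
    exact (isUnit_iff_isUnit_det _).2 (isUnit_of_mul_isUnit_right this)
  have hSdet := (isUnit_iff_isUnit_det _).1 hS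
  have hSHdet : IsUnit (Sᴴ).det := by rw [det_conjTranspose]; exact hSdet.star
  -- With `B = H + iK` and `H = S*S`, congruence by `S⁻¹` turns `H` into the identity. A unitary
  -- then diagonalizes what `K` has become without disturbing the identity.
  set K' : Matrix (Fin n) (Fin n) ℂ := (S⁻¹)ᴴ * K * S⁻¹ with hK'
  have hK'herm : K'.IsHermitian := isHermitian_conjTranspose_mul_mul _ hKherm
  obtain ⟨U, l, hUU, hspec⟩ : ∃ (U : Matrix (Fin n) (Fin n) ℂ) (l : Fin n → ℝ),
      U * Uᴴ = 1 ∧ K' = U * diagonal (fun k ↦ (l k : ℂ)) * Uᴴ := by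
    refine ⟨hK'herm.eigenvectorUnitary, hK'herm.eigenvalues,
      Unitary.mul_star_self_of_mem hK'herm.eigenvectorUnitary.2, ?_⟩
    have := hK'herm.spectral_theorem
    rw [Unitary.conjStarAlgAut_apply] at this
    exact this
  refine ⟨Uᴴ * S, l, ?_, ?_⟩
  · rw [isUnit_iff_isUnit_det, det_mul]
    refine IsUnit.mul ?_ hSdet
    have : IsUnit (U * Uᴴ).det := by rw [hUU]; simp
    rw [det_mul] at this
    exact isUnit_of_mul_isUnit_right this
  · have hdiag : diagonal (fun k ↦ 1 + Complex.I * (l k : ℂ)) =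
        1 + Complex.I • diagonal (fun k ↦ (l k : ℂ)) := by
      rw [← diagonal_one, ← diagonal_smul, diagonal_add]
      rfl
    have hKS : K = Sᴴ * K' * S := by
      rw [hK', conjTranspose_nonsing_inv]
      simp only [Matrix.mul_assoc]
      rw [nonsing_inv_mul _ hSdet, Matrix.mul_one, mul_nonsing_inv_cancel_left _ _ hSHdet]
    calc B = Sᴴ * (U * Uᴴ) * S + Complex.I • (Sᴴ * K' * S) := by
            rw [hUU, Matrix.mul_one, ← hHS, ← hKS, ← hBHK]
      _ = _ := by
            rw [hdiag, hspec, conjTranspose_mul, conjTranspose_conjTranspose]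
            simp only [Matrix.mul_add, Matrix.add_mul, Matrix.mul_one, Matrix.mul_smul,
              Matrix.smul_mul, Matrix.mul_assoc]

/-- The moduli of the diagonal entries `1 + i l` are absorbed into the congruence by their square
roots; the arguments that remain lie within `π / 2` of zero before the rotation by `θ` is undone. -/
lemma exists_phases_of_accretive {n : ℕ} {A : Matrix (Fin n) (Fin n) ℂ} {θ : ℝ}
    (hA : ∀ x : Fin n → ℂ, x ≠ 0 →
      0 < (Complex.exp (Complex.I * θ) * (star x ⬝ᵥ (A *ᵥ x))).re) :
    ∃ (T : Matrix (Fin n) (Fin n) ℂ) (φ : Fin n → ℝ), IsUnit T ∧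
      A = Tᴴ * diagonal (fun k ↦ Complex.exp (Complex.I * (φ k : ℂ))) * T ∧
      ∀ k, φ k ∈ Set.Ioo (-(Real.pi / 2) - θ) (Real.pi / 2 - θ) := by
  obtain ⟨V, l, hV, hBV⟩ := exists_congruence_of_accretive
    (B := Complex.exp (Complex.I * θ) • A) (by simpa [smul_mulVec] using hA)
  set c : Fin n → ℂ := fun k ↦ 1 + Complex.I * (l k : ℂ) with hc
  have hre (k) : 0 < (c k).re := by simp [hc]
  have hnorm (k) : 0 < ‖c k‖ := norm_pos_iff.2 fun h ↦ by simpa [h] using hre k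
  refine ⟨diagonal (fun k ↦ ((√‖c k‖ : ℝ) : ℂ)) * V, fun k ↦ (c k).arg - θ, ?_, ?_, fun k ↦ ?_⟩
  · rw [isUnit_iff_isUnit_det, det_mul, det_diagonal]
    refine IsUnit.mul ?_ ((isUnit_iff_isUnit_det _).1 hV)
    rw [isUnit_iff_ne_zero, Finset.prod_ne_zero_iff]
    intro k _
    exact_mod_cast (Real.sqrt_pos.2 (hnorm k)).ne'
  · have hA' : A = Complex.exp (-(Complex.I * θ)) • (Complex.exp (Complex.I * θ) • A) := by
      rw [smul_smul, ← Complex.exp_add, neg_add_cancel, Complex.exp_zero, one_smul]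
    rw [hA', hBV, conjTranspose_mul, diagonal_conjTranspose, ← Matrix.smul_mul, ← Matrix.mul_smul]
    simp only [Matrix.mul_assoc]
    congr 1
    simp only [← Matrix.mul_assoc]
    congr 1
    rw [diagonal_mul_diagonal, diagonal_mul_diagonal, ← diagonal_smul]
    congr 1
    funext k
    have h1 : ((√‖c k‖ : ℝ) : ℂ) * ((√‖c k‖ : ℝ) : ℂ) = (‖c k‖ : ℂ) := by
      rw [← Complex.ofReal_mul, Real.mul_self_sqrt (norm_nonneg _)]
    have h2 := Complex.norm_mul_exp_arg_mul_I (c k)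
    have h3 : Complex.exp (Complex.I * (((c k).arg - θ : ℝ) : ℂ)) =
        Complex.exp (-(Complex.I * θ)) * Complex.exp ((c k).arg * Complex.I) := by
      rw [← Complex.exp_add]
      congr 1
      push_cast
      ring
    simp only [Pi.smul_apply, smul_eq_mul, Pi.star_apply, RCLike.star_def, Complex.conj_ofReal]
    rw [h3]
    conv_lhs => rw [← h2, ← h1]
    ring
  · have := abs_lt.1 (Complex.abs_arg_lt_pi_div_two_iff.2 (Or.inl (hre k)))
    constructor <;> linarith [this.1, this.2]

/-- Two windows are needed: the open one around `a` bounds the spread by `π`, the closed one around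
`θ` places the center. They differ when phases reach the boundary of the closed phase set. -/
lemma isPhases_of_bounds {n : ℕ} (hn : 1 ≤ n) {A T : Matrix (Fin n) (Fin n) ℂ} {φ : Fin n → ℝ}
    (hT : IsUnit T)
    (hA : A = Tᴴ * diagonal (fun k ↦ Complex.exp (Complex.I * (φ k : ℂ))) * T) {a θ : ℝ}
    (ha : ∀ k, φ k ∈ Set.Ioo (a - Real.pi / 2) (a + Real.pi / 2))
    (hφ : ∀ k, φ k ∈ Set.Icc (θ - Real.pi / 2) (θ + Real.pi / 2))
    (hθ : θ ∈ Set.Ioo (-(Real.pi / 2)) (Real.pi / 2)) : IsPhases A φ := by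
  have : Nonempty (Fin n) := ⟨⟨0, hn⟩⟩
  obtain ⟨i, hi⟩ := exists_eq_ciSup_of_finite (f := φ)
  obtain ⟨j, hj⟩ := exists_eq_ciInf_of_finite (f := φ)
  refine ⟨⟨T, hT, hA⟩, ?_, ?_⟩
  · rw [← hi, ← hj]
    linarith [(ha i).2, (ha j).1]
  · rw [← hi, ← hj]
    constructor
    · linarith [(hφ i).1, (hφ j).1, hθ.1]
    · linarith [(hφ i).2, (hφ j).2, hθ.2]

/-- By the sectorial decomposition the rotated form is a combination of the numbers `cos (φ k + θ)`
with nonnegative weights, not all zero. This replaces phases by inequalities on forms. -/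
lemma mem_phaseSetOpen_iff {n : ℕ} (hn : 1 ≤ n) {A : Matrix (Fin n) (Fin n) ℂ} {θ : ℝ}
    (hθ : θ ∈ Set.Ioo (-(Real.pi / 2)) (Real.pi / 2)) :
    A ∈ phaseSetOpen n (-(Real.pi / 2) - θ) (Real.pi / 2 - θ) ↔
      ∀ x : Fin n → ℂ, x ≠ 0 →
        0 < (Complex.exp (Complex.I * θ) * (star x ⬝ᵥ (A *ᵥ x))).re := by
  have : Nonempty (Fin n) := ⟨⟨0, hn⟩⟩
  constructor
  · rintro ⟨-, φ, ⟨⟨T, hT, rfl⟩, -, -⟩, h1, h2⟩ x hx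
    rw [re_exp_mul_form]
    have hcos (k) : 0 < Real.cos (φ k + θ) := by
      have h3 := ciInf_le (Set.finite_range φ).bddBelow k
      have h4 := le_ciSup (Set.finite_range φ).bddAbove k
      exact Real.cos_pos_of_mem_Ioo ⟨by linarith, by linarith⟩
    have hTx : T *ᵥ x ≠ 0 := fun h ↦ hx
      (mulVec_injective_of_isUnit hT (h.trans (mulVec_zero T).symm))
    obtain ⟨k, hk⟩ := Function.ne_iff.1 hTx
    refine Finset.sum_pos' (fun k _ ↦ mul_nonneg (sq_nonneg _) (hcos k).le)
      ⟨k, Finset.mem_univ _, mul_pos (pow_pos (norm_pos_iff.2 hk) _) (hcos k)⟩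
  · intro h
    obtain ⟨T, φ, hT, hA, hφ⟩ := exists_phases_of_accretive h
    obtain ⟨i, hi⟩ := exists_eq_ciSup_of_finite (f := φ)
    obtain ⟨j, hj⟩ := exists_eq_ciInf_of_finite (f := φ)
    refine ⟨isSectorial_iff.2 fun x hx h0 ↦ by simpa [h0] using h x hx, φ,
      isPhases_of_bounds hn hT hA (a := -θ) (θ := -θ) (fun k ↦ ?_) (fun k ↦ ?_) ?_, ?_, ?_⟩
    · exact ⟨by linarith [(hφ k).1], by linarith [(hφ k).2]⟩
    · exact ⟨by linarith [(hφ k).1], by linarith [(hφ k).2]⟩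
    · exact ⟨by linarith [hθ.2], by linarith [hθ.1]⟩
    · rw [← hj]; exact (hφ j).1
    · rw [← hi]; exact (hφ i).2

lemma re_nonneg_of_mem_phaseSetClosed {n : ℕ} {A : Matrix (Fin n) (Fin n) ℂ}
    {θ : ℝ} (hA : A ∈ phaseSetClosed n (-(Real.pi / 2) + θ) (Real.pi / 2 + θ)) (x : Fin n → ℂ) :
    0 ≤ (Complex.exp (Complex.I * (-θ : ℝ)) * (star x ⬝ᵥ (A *ᵥ x))).re := by
  obtain ⟨-, φ, ⟨⟨T, hT, rfl⟩, -, -⟩, h1, h2⟩ := hA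
  rw [re_exp_mul_form]
  refine Finset.sum_nonneg fun k _ ↦ mul_nonneg (sq_nonneg _) ?_
  have h3 := ciInf_le (Set.finite_range φ).bddBelow k
  have h4 := le_ciSup (Set.finite_range φ).bddAbove k
  exact Real.cos_nonneg_of_mem_Icc ⟨by linarith, by linarith⟩

lemma form_smul {n : ℕ} (A : Matrix (Fin n) (Fin n) ℂ) (c : ℂ) (x : Fin n → ℂ) :
    star (c • x) ⬝ᵥ (A *ᵥ (c • x)) = ((‖c‖ ^ 2 : ℝ) : ℂ) * (star x ⬝ᵥ (A *ᵥ x)) := by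
  rw [star_smul, mulVec_smul, smul_dotProduct, dotProduct_smul, smul_eq_mul, smul_eq_mul,
    ← mul_assoc, RCLike.star_def, ← Complex.normSq_eq_conj_mul_self, Complex.normSq_eq_norm_sq]

/-- If the real part of the form of `B` is nonnegative and its imaginary part is positive wherever
the real part vanishes, then `B` becomes accretive after a small rotation. -/
lemma exists_add_mul_im_pos {n : ℕ} (B : Matrix (Fin n) (Fin n) ℂ) (ε : ℝ)
    (h0 : ∀ x : Fin n → ℂ, 0 ≤ (star x ⬝ᵥ (B *ᵥ x)).re)
    (h1 : ∀ x : Fin n → ℂ, x ≠ 0 → (star x ⬝ᵥ (B *ᵥ x)).re = 0 →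
      0 < ε * (star x ⬝ᵥ (B *ᵥ x)).im) :
    ∃ t : ℝ, 0 < t ∧ ∀ x : Fin n → ℂ, x ≠ 0 →
      0 < (star x ⬝ᵥ (B *ᵥ x)).re + t * (ε * (star x ⬝ᵥ (B *ᵥ x)).im) := by
  set f : (Fin n → ℂ) → ℝ := fun x ↦ (star x ⬝ᵥ (B *ᵥ x)).re
  set g : (Fin n → ℂ) → ℝ := fun x ↦ ε * (star x ⬝ᵥ (B *ᵥ x)).im
  have hq : Continuous fun x : Fin n → ℂ ↦ star x ⬝ᵥ (B *ᵥ x) := by fun_prop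
  have hf : Continuous f := Complex.continuous_re.comp hq
  have hg : Continuous g := continuous_const.mul (Complex.continuous_im.comp hq)
  set K : Set (Fin n → ℂ) := Metric.sphere 0 1 ∩ {x | g x ≤ 0} with hK
  have hKc : IsCompact K := (isCompact_sphere _ _).inter_right (isClosed_le hg continuous_const)
  have hfK : ∀ x ∈ K, 0 < f x := fun x hx ↦ by
    refine lt_of_le_of_ne (h0 x) fun h ↦ (h1 x ?_ h.symm).not_ge hx.2
    rintro rfl
    simpa using hx.1
  obtain ⟨m, hm0, hm⟩ : ∃ m : ℝ, 0 < m ∧ ∀ x ∈ K, m ≤ f x := by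
    rcases K.eq_empty_or_nonempty with he | hne
    · exact ⟨1, one_pos, by simp [he]⟩
    · obtain ⟨p, hp, hmin⟩ := hKc.exists_isMinOn hne hf.continuousOn
      exact ⟨f p, hfK p hp, fun x hx ↦ hmin hx⟩
  obtain ⟨M, hM⟩ := hKc.exists_bound_of_continuousOn hg.continuousOn
  have hM1 : 0 < |M| + 1 := by positivity
  -- Where `g ≤ 0` on the unit sphere, `f ≥ m` and `|g| ≤ M`, so this multiple of `|g|` stays below
  -- `m`. Where `g > 0` nothing is required beyond `f ≥ 0`.
  refine ⟨m / (|M| + 1), div_pos hm0 hM1, fun x hx ↦ ?_⟩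
  have hnx : 0 < ‖x‖ := norm_pos_iff.2 hx
  set y : Fin n → ℂ := ((‖x‖⁻¹ : ℝ) : ℂ) • x with hy
  have hsphere : ∀ y ∈ Metric.sphere (0 : Fin n → ℂ) 1, 0 < f y + m / (|M| + 1) * g y := by
    intro y hy
    by_cases hgy : g y ≤ 0
    · have h2 := hm y ⟨hy, hgy⟩
      have h3 := neg_abs_le (g y)
      have h4 : |g y| < |M| + 1 := by
        have := hM y ⟨hy, hgy⟩
        rw [Real.norm_eq_abs] at this
        linarith [le_abs_self M]
      have h5 : m / (|M| + 1) * |g y| < m := by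
        rw [div_mul_eq_mul_div, div_lt_iff₀ hM1]
        exact mul_lt_mul_of_pos_left h4 hm0
      nlinarith [div_pos hm0 hM1]
    · push Not at hgy
      exact add_pos_of_nonneg_of_pos (h0 y) (mul_pos (div_pos hm0 hM1) hgy)
  have hxy : x = ((‖x‖ : ℝ) : ℂ) • y := by
    rw [hy, smul_smul, ← Complex.ofReal_mul, mul_inv_cancel₀ hnx.ne', Complex.ofReal_one, one_smul]
  have hyS : y ∈ Metric.sphere (0 : Fin n → ℂ) 1 := by
    simp [hy, norm_smul, hnx.ne']
  have := hsphere y hyS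
  rw [hxy, form_smul, Complex.re_ofReal_mul, Complex.im_ofReal_mul]
  have h6 : 0 < ‖((‖x‖ : ℝ) : ℂ)‖ ^ 2 := by
    rw [Complex.norm_real, norm_norm]; exact pow_pos hnx 2
  calc 0 < ‖((‖x‖ : ℝ) : ℂ)‖ ^ 2 * (f y + m / (|M| + 1) * g y) := mul_pos h6 this
    _ = _ := by simp only [f, g]; ring

/-- A small rotation towards the side named by `ε` makes the form strictly accretive, which yields
phases with spread below `π`. If both imaginary half axes were met, the spread would be `π` and no
such rotation would exist. -/
lemma mem_phaseSetClosed_of_form {n : ℕ} (hn : 1 ≤ n) {A : Matrix (Fin n) (Fin n) ℂ} {θ ε : ℝ}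
    (hθ : θ ∈ Set.Ioo (-(Real.pi / 2)) (Real.pi / 2)) (hε : ε = 1 ∨ ε = -1)
    (h0 : ∀ x : Fin n → ℂ, 0 ≤ (Complex.exp (Complex.I * (-θ : ℝ)) * (star x ⬝ᵥ (A *ᵥ x))).re)
    (h1 : ∀ x : Fin n → ℂ, x ≠ 0 →
      (Complex.exp (Complex.I * (-θ : ℝ)) * (star x ⬝ᵥ (A *ᵥ x))).re = 0 →
      0 < ε * (Complex.exp (Complex.I * (-θ : ℝ)) * (star x ⬝ᵥ (A *ᵥ x))).im) :
    A ∈ phaseSetClosed n (-(Real.pi / 2) + θ) (Real.pi / 2 + θ) := by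
  have : Nonempty (Fin n) := ⟨⟨0, hn⟩⟩
  have hsm (x : Fin n → ℂ) : star x ⬝ᵥ ((Complex.exp (Complex.I * (-θ : ℝ)) • A) *ᵥ x) =
      Complex.exp (Complex.I * (-θ : ℝ)) * (star x ⬝ᵥ (A *ᵥ x)) := by
    rw [smul_mulVec, dotProduct_smul, smul_eq_mul]
  obtain ⟨t, ht, hpos⟩ := exists_add_mul_im_pos (Complex.exp (Complex.I * (-θ : ℝ)) • A) ε
    (by simpa only [hsm] using h0) (by simpa only [hsm] using h1)
  simp only [hsm] at hpos
  set δ : ℝ := Real.arctan t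
  have hδ0 : 0 < δ := Real.arctan_pos.2 ht
  have hδ1 : δ < Real.pi / 2 := Real.arctan_lt_pi_div_two t
  have hcos : 0 < Real.cos δ := Real.cos_arctan_pos t
  have hsin : Real.sin δ = t * Real.cos δ := by
    have := Real.tan_arctan t
    rw [Real.tan_eq_sin_div_cos, div_eq_iff hcos.ne'] at this
    exact this
  have hrot (x : Fin n → ℂ) (hx : x ≠ 0) :
      0 < (Complex.exp (Complex.I * (-θ - ε * δ : ℝ)) * (star x ⬝ᵥ (A *ᵥ x))).re := by
    have hexp : Complex.exp (Complex.I * (-θ - ε * δ : ℝ)) =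
        Complex.exp ((-(ε * δ) : ℝ) * Complex.I) * Complex.exp (Complex.I * (-θ : ℝ)) := by
      rw [← Complex.exp_add]
      congr 1
      push_cast
      ring
    have hc : Real.cos (-(ε * δ)) = Real.cos δ := by
      rcases hε with rfl | rfl <;> simp
    have hs : Real.sin (-(ε * δ)) = -(ε * Real.sin δ) := by
      rcases hε with rfl | rfl <;> simp
    rw [hexp, mul_assoc, Complex.mul_re, Complex.exp_ofReal_mul_I_re, Complex.exp_ofReal_mul_I_im,
      hc, hs, hsin]
    nlinarith [mul_pos hcos (hpos x hx)]
  obtain ⟨T, φ, hT, hA, hφ⟩ := exists_phases_of_accretive hrot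
  have hIcc (k) : φ k ∈ Set.Icc (θ - Real.pi / 2) (θ + Real.pi / 2) := by
    have hTdet := (isUnit_iff_isUnit_det _).1 hT
    -- This vector isolates the `k`-th phase: the form becomes `cos (φ k - θ)`. Its nonnegativity,
    -- with the rotated window, confines `φ k` to the closed window around `θ`.
    have hk := h0 (T⁻¹ *ᵥ Pi.single k 1)
    rw [hA, re_exp_mul_form, mulVec_mulVec, mul_nonsing_inv _ hTdet, one_mulVec,
      Finset.sum_eq_single k (fun j _ hj ↦ by simp [hj]) (by simp)] at hk
    simp only [Pi.single_eq_same, norm_one, one_pow, one_mul] at hk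
    obtain ⟨h2, h3⟩ := hφ k
    constructor
    · by_contra! hlt
      have : Real.cos (-(φ k + -θ)) < 0 :=
        Real.cos_neg_of_pi_div_two_lt_of_lt (by linarith)
          (by rcases hε with rfl | rfl <;> linarith)
      rw [Real.cos_neg] at this
      linarith
    · by_contra! hlt
      have : Real.cos (φ k + -θ) < 0 :=
        Real.cos_neg_of_pi_div_two_lt_of_lt (by linarith)
          (by rcases hε with rfl | rfl <;> linarith)
      linarith
  obtain ⟨i, hi⟩ := exists_eq_ciSup_of_finite (f := φ)
  obtain ⟨j, hj⟩ := exists_eq_ciInf_of_finite (f := φ)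
  refine ⟨isSectorial_iff.2 fun x hx hz ↦ by simpa [hz] using hrot x hx, φ,
    isPhases_of_bounds hn hT hA (a := θ + ε * δ) (fun k ↦ ?_) hIcc hθ, ?_, ?_⟩
  · exact ⟨by linarith [(hφ k).1], by linarith [(hφ k).2]⟩
  · rw [← hj]; linarith [(hIcc j).1]
  · rw [← hi]; linarith [(hIcc i).2]

end Phases

/-! ### Feedback stability as nonvanishing of a determinant on the disk -/

section StableMatrices

open Matrix

lemma IsStableTM.exists_lift {m n : Type*} {G : Matrix m n (RatFunc ℝ)} (hG : IsStableTM G) :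
    ∃ G₀ : Matrix m n RHInfRing, G = G₀.map RHInfRing.subtype :=
  ⟨fun i j ↦ ⟨G i j, hG i j⟩, rfl⟩

lemma isStableTM_map {m n : Type*} (G : Matrix m n RHInfRing) :
    IsStableTM (G.map RHInfRing.subtype) := fun i j ↦ (G i j).2

lemma map_diskValue_map_subtype {m n : Type*} (G : Matrix m n RHInfRing) {z : ℂ} (hz : ‖z‖ ≤ 1) :
    (G.map RHInfRing.subtype).map (diskValue z) = G.map (diskEval z hz) := rfl

lemma IsStableTM.mul {l m n : Type*} [Fintype m] {G : Matrix l m (RatFunc ℝ)}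
    {H : Matrix m n (RatFunc ℝ)} (hG : IsStableTM G) (hH : IsStableTM H) : IsStableTM (G * H) := by
  obtain ⟨G₀, rfl⟩ := hG.exists_lift
  obtain ⟨H₀, rfl⟩ := hH.exists_lift
  rw [← Matrix.map_mul]
  exact isStableTM_map _

lemma IsStableTM.map_diskValue_mul {l m n : Type*} [Fintype m] {G : Matrix l m (RatFunc ℝ)}
    {H : Matrix m n (RatFunc ℝ)} (hG : IsStableTM G) (hH : IsStableTM H) {z : ℂ} (hz : ‖z‖ ≤ 1) :
    (G * H).map (diskValue z) = G.map (diskValue z) * H.map (diskValue z) := by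
  obtain ⟨G₀, rfl⟩ := hG.exists_lift
  obtain ⟨H₀, rfl⟩ := hH.exists_lift
  rw [← Matrix.map_mul, map_diskValue_map_subtype _ hz, map_diskValue_map_subtype _ hz,
    map_diskValue_map_subtype _ hz, Matrix.map_mul]

variable {n : ℕ} {P C : Matrix (Fin n) (Fin n) (RatFunc ℝ)}

/-- The upper left block of the Gang of Four is `(1 + C P)⁻¹`, so stability makes `1 + C P`
invertible over the ring of stable functions. Conversely, a nonvanishing determinant is a unit
there, and the adjugate gives a stable inverse. -/
lemma feedbackStable_iff (hP : IsStableTM P) (hC : IsStableTM C) :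
    FeedbackStable P C ↔ ∀ z : ℂ, ‖z‖ ≤ 1 →
      (1 + C.map (diskValue z) * P.map (diskValue z)).det ≠ 0 := by
  obtain ⟨P₀, rfl⟩ := hP.exists_lift
  obtain ⟨C₀, rfl⟩ := hC.exists_lift
  have hinj : Function.Injective
      fun M : Matrix (Fin n) (Fin n) RHInfRing ↦ M.map RHInfRing.subtype :=
    Matrix.map_injective Subtype.val_injective
  have hmap : 1 + C₀.map RHInfRing.subtype * P₀.map RHInfRing.subtype =
      (1 + C₀ * P₀).map RHInfRing.subtype := by
    rw [Matrix.map_add _ (map_add _), Matrix.map_mul, Matrix.map_one _ (map_zero _) (map_one _)]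
  have heval (z : ℂ) (hz : ‖z‖ ≤ 1) :
      1 + (C₀.map RHInfRing.subtype).map (diskValue z) *
        (P₀.map RHInfRing.subtype).map (diskValue z) = (1 + C₀ * P₀).map (diskEval z hz) := by
    rw [map_diskValue_map_subtype _ hz, map_diskValue_map_subtype _ hz,
      Matrix.map_add _ (map_add _), Matrix.map_mul, Matrix.map_one _ (map_zero _) (map_one _)]
  constructor
  · rintro ⟨hunit, hstable⟩ z hz
    have hinv : IsStableTM (1 + C₀.map RHInfRing.subtype * P₀.map RHInfRing.subtype)⁻¹ := by
      intro i j
      have := hstable (Sum.inl i) (Sum.inl j)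
      rwa [gangOfFour, Matrix.fromRows_mul, Matrix.fromRows_mul_fromCols, Matrix.one_mul,
        Matrix.mul_one, Matrix.fromBlocks_apply₁₁] at this
    obtain ⟨N₀, hN₀⟩ := hinv.exists_lift
    have h1 : (1 + C₀ * P₀) * N₀ = 1 := by
      apply hinj
      simp only
      rw [Matrix.map_mul, ← hmap, ← hN₀, Matrix.mul_nonsing_inv _ ((isUnit_iff_isUnit_det _).1 hunit),
        Matrix.map_one _ (map_zero _) (map_one _)]
    rw [heval z hz]
    have h2 := congrArg (fun M ↦ (M.map (diskEval z hz)).det) h1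
    simp only [Matrix.map_mul, Matrix.map_one _ (map_zero _) (map_one _), det_mul, det_one] at h2
    exact left_ne_zero_of_mul_eq_one h2
  · intro h
    obtain ⟨g, hg⟩ := exists_inverse_of_diskValue_ne_zero (1 + C₀ * P₀).det fun z hz ↦ by
      rw [← diskEval_apply z hz, RingHom.map_det, RingHom.mapMatrix_apply, ← heval z hz]
      exact h z hz
    set N₀ := g • (1 + C₀ * P₀).adjugate
    have h1 : N₀ * (1 + C₀ * P₀) = 1 := by
      rw [Matrix.smul_mul, adjugate_mul, smul_smul, mul_comm, hg, one_smul]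
    have h2 : N₀.map RHInfRing.subtype *
        (1 + C₀.map RHInfRing.subtype * P₀.map RHInfRing.subtype) = 1 := by
      rw [hmap, ← Matrix.map_mul, h1, Matrix.map_one _ (map_zero _) (map_one _)]
    refine ⟨(isUnit_iff_isUnit_det _).2 (isUnit_det_of_left_inverse h2), ?_⟩
    have h3 : fromRows (1 : Matrix (Fin n) (Fin n) (RatFunc ℝ)) (P₀.map RHInfRing.subtype) =
        (fromRows 1 P₀).map RHInfRing.subtype := by
      ext (i | i) j
      · simp [Matrix.one_apply]; split_ifs <;> rfl
      · rfl
    have h4 : fromCols (1 : Matrix (Fin n) (Fin n) (RatFunc ℝ)) (C₀.map RHInfRing.subtype) =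
        (fromCols 1 C₀).map RHInfRing.subtype := by
      ext i (j | j)
      · simp [Matrix.one_apply]; split_ifs <;> rfl
      · rfl
    rw [gangOfFour, inv_eq_left_inv h2, h3, h4]
    exact ((isStableTM_map _).mul (isStableTM_map _)).mul (isStableTM_map _)

end StableMatrices

/-! ### Operator norm bounds -/

section Gain

open Matrix

lemma norm_toLp_mulVec_le {n : ℕ} (A : Matrix (Fin n) (Fin n) ℂ) (x : Fin n → ℂ) :
    ‖WithLp.toLp 2 (A *ᵥ x)‖ ≤ maxSingularValue A * ‖WithLp.toLp 2 x‖ := by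
  simpa [maxSingularValue] using
    (Matrix.toEuclideanCLM (n := Fin n) (𝕜 := ℂ) A).le_opNorm (WithLp.toLp 2 x)

lemma maxSingularValue_le {n : ℕ} {A : Matrix (Fin n) (Fin n) ℂ} {c : ℝ} (hc : 0 ≤ c)
    (h : ∀ x : Fin n → ℂ, ‖WithLp.toLp 2 (A *ᵥ x)‖ ≤ c * ‖WithLp.toLp 2 x‖) :
    maxSingularValue A ≤ c :=
  ContinuousLinearMap.opNorm_le_bound _ hc fun x ↦ h x.ofLp

end Gain

/-! ### Sufficiency: the homotopy from zero loop gain -/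

section Sufficiency

open Matrix

/-- The pointwise small vase condition keeps `1 + τ A B` nonsingular. -/
lemma det_one_add_smul_mul_ne_zero {n : ℕ} (hn : 1 ≤ n) {A B : Matrix (Fin n) (Fin n) ℂ}
    {θ γ : ℝ} (hθ : θ ∈ Set.Ioo (-(Real.pi / 2)) (Real.pi / 2))
    (hA : A ∈ phaseSetOpen n (-(Real.pi / 2) - θ) (Real.pi / 2 - θ) ∩ gainSetOpen n γ⁻¹)
    (hB : B ∈ phaseSetClosed n (-(Real.pi / 2) + θ) (Real.pi / 2 + θ) ∪ gainSetClosed n γ)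
    {τ : ℝ} (hτ : τ ∈ Set.Icc (0 : ℝ) 1) : (1 + (τ : ℂ) • (A * B)).det ≠ 0 := by
  intro hdet
  obtain ⟨x, hx, hx0⟩ := exists_mulVec_eq_zero_iff.2 hdet
  have hxe : x = -((τ : ℂ) • (A *ᵥ (B *ᵥ x))) := by
    rw [add_mulVec, one_mulVec, smul_mulVec, ← mulVec_mulVec] at hx0
    exact eq_neg_of_add_eq_zero_left hx0
  have hxn : 0 < ‖WithLp.toLp 2 x‖ := norm_pos_iff.2 (by simpa using hx)
  rcases hB with hB | hB
  · set y := B *ᵥ x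
    have hy : y ≠ 0 := fun h ↦ hx (by rw [hxe, h]; simp)
    have hτ0 : 0 < τ := lt_of_le_of_ne hτ.1 fun h ↦ hx (by rw [hxe, ← h]; simp)
    have h1 := (mem_phaseSetOpen_iff hn hθ).1 hA.1 y hy
    have h2 := re_nonneg_of_mem_phaseSetClosed hB x
    have h3 : star y ⬝ᵥ x = -((τ : ℂ) * (star y ⬝ᵥ (A *ᵥ y))) := by
      conv_lhs => rw [hxe]
      rw [dotProduct_neg, dotProduct_smul, smul_eq_mul]
    have h4 : star x ⬝ᵥ y = starRingEnd ℂ (star y ⬝ᵥ x) := by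
      rw [star_dotProduct]; rfl
    -- Since `x = -τ A y` and `y = B x`, the rotated form of `B` at `x` is the conjugate of `-τ`
    -- times the rotated form of `A` at `y`. The first has nonnegative real part, the second
    -- negative.
    have h5 : Complex.exp (Complex.I * (-θ : ℝ)) * (star x ⬝ᵥ y) =
        starRingEnd ℂ (-((τ : ℂ) * (Complex.exp (Complex.I * θ) * (star y ⬝ᵥ (A *ᵥ y))))) := by
      rw [h4, h3]
      simp only [map_neg, map_mul, ← Complex.exp_conj, Complex.conj_I, Complex.conj_ofReal]
      push_cast
      ring_nf
    rw [h5, Complex.conj_re, Complex.neg_re, Complex.re_ofReal_mul] at h2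
    nlinarith [mul_pos hτ0 h1]
  · have hA2 : maxSingularValue A < γ⁻¹ := hA.2
    have hB2 : maxSingularValue B ≤ γ := hB
    have hA0 : 0 ≤ maxSingularValue A := norm_nonneg _
    have hγ : 0 < γ := inv_pos.1 (hA0.trans_lt hA2)
    have h1 : ‖WithLp.toLp 2 x‖ ≤ ‖WithLp.toLp 2 (A *ᵥ (B *ᵥ x))‖ := by
      conv_lhs => rw [hxe]
      rw [WithLp.toLp_neg, WithLp.toLp_smul, norm_neg, norm_smul, Complex.norm_real,
        Real.norm_of_nonneg hτ.1]
      exact mul_le_of_le_one_left (norm_nonneg _) hτ.2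
    have h2 := norm_toLp_mulVec_le A (B *ᵥ x)
    have h3 := norm_toLp_mulVec_le B x
    have h4 : maxSingularValue A * γ < 1 := by
      calc maxSingularValue A * γ < γ⁻¹ * γ := mul_lt_mul_of_pos_right hA2 hγ
        _ = 1 := inv_mul_cancel₀ hγ.ne'
    have h5 : ‖WithLp.toLp 2 (B *ᵥ x)‖ ≤ γ * ‖WithLp.toLp 2 x‖ :=
      h3.trans (mul_le_mul_of_nonneg_right hB2 hxn.le)
    nlinarith [mul_le_mul_of_nonneg_left h5 hA0]

lemma det_one_add_mul_ne_zero_of_circle {n : ℕ} {L : Matrix (Fin n) (Fin n) (RatFunc ℝ)}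
    (hL : IsStableTM L)
    (h : ∀ τ ∈ Set.Icc (0 : ℝ) 1, ∀ z : ℂ, ‖z‖ = 1 →
      (1 + (τ : ℂ) • L.map (diskValue z)).det ≠ 0) {z : ℂ} (hz : ‖z‖ ≤ 1) :
    (1 + L.map (diskValue z)).det ≠ 0 := by
  have := ne_zero_of_homotopy (F := fun τ z ↦ (1 + (τ : ℂ) • L.map (diskValue z)).det) ?_ ?_ h
    (by simp) hz
  · simpa using this
  · refine (continuous_id.matrix_det).comp_continuousOn
      (f := fun p : ℝ × ℂ ↦ 1 + (p.1 : ℂ) • L.map (diskValue p.2)) ?_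
    refine continuousOn_pi.2 fun i ↦ continuousOn_pi.2 fun j ↦ ?_
    simp only [Matrix.add_apply, Matrix.smul_apply, map_apply, smul_eq_mul]
    exact continuousOn_const.add ((by fun_prop : Continuous fun p : ℝ × ℂ ↦ (p.1 : ℂ)).continuousOn.mul
      ((continuousOn_diskValue (hL i j)).comp continuousOn_snd fun p hp ↦ hp.2))
  · intro τ _
    simp only [det_apply]
    refine DifferentiableOn.fun_sum fun σ _ ↦ DifferentiableOn.const_smul ?_ _
    refine DifferentiableOn.fun_finsetProd fun i _ ↦ ?_
    simp only [Matrix.add_apply, Matrix.smul_apply, map_apply, smul_eq_mul]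
    exact ((differentiableOn_diskValue (hL _ _)).const_mul _).const_add _

lemma freqResponse_neg {n : ℕ} (G : Matrix (Fin n) (Fin n) (RatFunc ℝ)) (ω : EReal) :
    freqResponse G (-ω) = (freqResponse G ω).map (starRingEnd ℂ) := by
  ext i j
  exact freqValue_neg ω

/-- Nonnegative frequencies suffice because real coefficients make the response at `-ω` the
conjugate of that at `ω`. -/
lemma feedbackStable_of_forall_frequency {n : ℕ} {P C : Matrix (Fin n) (Fin n) (RatFunc ℝ)}
    (hP : IsStableTM P) (hC : IsStableTM C)
    (h : ∀ ω : EReal, 0 ≤ ω → ∀ τ ∈ Set.Icc (0 : ℝ) 1,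
      (1 + (τ : ℂ) • (freqResponse C ω * freqResponse P ω)).det ≠ 0) : FeedbackStable P C := by
  refine (feedbackStable_iff hP hC).2 fun z hz ↦ ?_
  rw [← hC.map_diskValue_mul hP hz]
  refine det_one_add_mul_ne_zero_of_circle (hC.mul hP) (fun τ hτ z hz ↦ ?_) hz
  obtain ⟨ω, hω⟩ := exists_frequency hz
  have hCω : C.map (diskValue z) = freqResponse C ω := by
    ext i j; exact (hω _ (hC i j)).symm
  have hPω : P.map (diskValue z) = freqResponse P ω := by
    ext i j; exact (hω _ (hP i j)).symm
  rw [hC.map_diskValue_mul hP hz.le, hCω, hPω]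
  rcases le_total 0 ω with h0 | h0
  · exact h ω h0 τ hτ
  · have h1 := h (-ω) (by simpa using EReal.neg_le_neg_iff.2 h0) τ hτ
    rw [freqResponse_neg, freqResponse_neg, ← Matrix.map_mul] at h1
    intro hdet
    refine h1 ?_
    have h2 : 1 + (τ : ℂ) • (freqResponse C ω * freqResponse P ω).map (starRingEnd ℂ) =
        (starRingEnd ℂ).mapMatrix (1 + (τ : ℂ) • (freqResponse C ω * freqResponse P ω)) := by
      rw [map_add, map_one, RingHom.mapMatrix_apply]
      congr 1
      ext i j
      rw [Matrix.smul_apply, map_apply, map_apply, Matrix.smul_apply, smul_eq_mul, smul_eq_mul,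
        map_mul, Complex.conj_ofReal]
    rw [h2, ← RingHom.map_det, hdet, map_zero]

end Sufficiency

/-! ### Boundary interpolation with constant modulus -/

section Interpolation

open Polynomial

lemma projEval_X_add_C (a b : ℂ) (c : ℝ) : projEval a b 1 (X + C c) = a + c * b := by
  simp [projEval]

/-- The function is `(s - 1) / (s + 1)`, the inverse Cayley map; it serves as the coordinate of the
disk. -/
lemma exists_diskValue_eq_self :
    ∃ f : RHInfRing, ∀ z : ℂ, ‖z‖ ≤ 1 → diskValue z f = z := by
  have hq (z : ℂ) : projEval (1 + z) (1 - z) 1 (X + C (1 : ℝ)) = 2 := by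
    rw [projEval_X_add_C]; push_cast; ring
  have hp (z : ℂ) : projEval (1 + z) (1 - z) 1 (X + C (-1 : ℝ)) = 2 * z := by
    rw [projEval_X_add_C]; push_cast; ring
  have hmem : algebraMap ℝ[X] (RatFunc ℝ) (X + C (-1 : ℝ)) /
      algebraMap ℝ[X] (RatFunc ℝ) (X + C (1 : ℝ)) ∈ RHInf :=
    mem_RHInf_of_eq_div (natDegree_X_add_C _).le (natDegree_X_add_C _).le
      (fun z _ ↦ by rw [hq]; exact two_ne_zero) rfl
  refine ⟨⟨_, hmem⟩, fun z hz ↦ ?_⟩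
  rw [diskValue_eq_div hmem hz (natDegree_X_add_C _).le (natDegree_X_add_C _).le
    (by rw [hq]; exact two_ne_zero) rfl, hq, hp, mul_div_cancel_left₀ _ two_ne_zero]

/-- The real constants as stable transfer functions. -/
noncomputable def constTF (c : ℝ) : RHInfRing := ⟨RatFunc.C c, C_mem_RHInf c⟩

lemma diskEval_constTF {z : ℂ} (hz : ‖z‖ ≤ 1) (c : ℝ) : diskEval z hz (constTF c) = c :=
  diskValue_C z c

lemma re_sq_add_im_sq_of_norm_eq_one {z : ℂ} (hz : ‖z‖ = 1) :
    z.re * z.re + z.im * z.im = 1 := by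
  rw [← Complex.normSq_apply, Complex.normSq_eq_norm_sq, hz, one_pow]

lemma exists_allpass_of_pos {z₀ u : ℂ} (hz₀ : ‖z₀‖ = 1) (hu : ‖u‖ = 1)
    (hpos : 0 < z₀.im * u.im) :
    ∃ f : RHInfRing, diskValue z₀ f = u ∧ ∀ z, ‖z‖ = 1 → ‖diskValue z f‖ = 1 := by
  have hz2 := re_sq_add_im_sq_of_norm_eq_one hz₀
  have hu2 := re_sq_add_im_sq_of_norm_eq_one hu
  have hzim : 0 < z₀.im ^ 2 := by
    have : z₀.im ≠ 0 := fun h ↦ by simp [h] at hpos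
    positivity
  have huim : 0 < u.im ^ 2 := by
    have : u.im ≠ 0 := fun h ↦ by simp [h] at hpos
    positivity
  have h1 : 0 < 1 - z₀.re := by nlinarith
  have h2 : 0 < 1 + u.re := by nlinarith
  -- The all-pass function is `(s - α) / (s + α)`. Solving for value `u` at `s₀ = (1 + z₀) / (1 -
  -- z₀)` gives `α = s₀ (1 - u) / (1 + u)`, a product of two imaginary numbers; the sign hypothesis
  -- makes it positive.
  set α : ℝ := z₀.im * u.im / ((1 - z₀.re) * (1 + u.re)) with hα
  have hα0 : 0 < α := div_pos hpos (mul_pos h1 h2)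
  obtain ⟨ζ, hζ⟩ := exists_diskValue_eq_self
  set d : RHInfRing := constTF (1 + α) + constTF (1 - α) * ζ
  have hd (z : ℂ) (hz : ‖z‖ ≤ 1) : diskValue z d = (1 + α : ℝ) + (1 - α : ℝ) * z := by
    rw [← diskEval_apply z hz, map_add, map_mul, diskEval_constTF, diskEval_constTF,
      diskEval_apply, hζ z hz]
  have hd0 (z : ℂ) (hz : ‖z‖ ≤ 1) : diskValue z d ≠ 0 := by
    rw [hd z hz]
    intro h
    have h3 : ‖((1 + α : ℝ) : ℂ)‖ = ‖((1 - α : ℝ) : ℂ) * z‖ := by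
      rw [eq_neg_of_add_eq_zero_left h, norm_neg]
    rw [norm_mul, Complex.norm_real, Complex.norm_real, Real.norm_eq_abs, Real.norm_eq_abs,
      abs_of_pos (by linarith)] at h3
    have h4 : |1 - α| < 1 + α := abs_lt.2 ⟨by linarith, by linarith⟩
    nlinarith [abs_nonneg (1 - α), mul_le_mul_of_nonneg_left hz (abs_nonneg (1 - α))]
  obtain ⟨k, hk⟩ := exists_inverse_of_diskValue_ne_zero d hd0
  have hval (z : ℂ) (hz : ‖z‖ ≤ 1) :
      diskValue z ((constTF (1 - α) + constTF (1 + α) * ζ) * k : RHInfRing) =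
      ((1 - α : ℝ) + (1 + α : ℝ) * z) / ((1 + α : ℝ) + (1 - α : ℝ) * z) := by
    have h3 := congrArg (diskEval z hz) hk
    rw [map_mul, map_one, diskEval_apply z hz d] at h3
    rw [← diskEval_apply z hz, map_mul, map_add, map_mul, diskEval_constTF, diskEval_constTF,
      diskEval_apply z hz ζ, hζ z hz, eq_div_iff (by rw [← hd z hz]; exact hd0 z hz), ← hd z hz,
      mul_assoc, mul_comm (diskEval z hz k), h3, mul_one]
  refine ⟨(constTF (1 - α) + constTF (1 + α) * ζ) * k, ?_, fun z hz ↦ ?_⟩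
  · have hA : (1 + z₀) * (1 - z₀.re : ℝ) = Complex.I * z₀.im * (1 - z₀) := by
      apply Complex.ext <;> simp
      nlinarith
    have hB : (1 - u) * (1 + u.re : ℝ) = -Complex.I * u.im * (1 + u) := by
      apply Complex.ext <;> simp
      nlinarith
    have hαeq : α * ((1 - z₀.re) * (1 + u.re)) = z₀.im * u.im :=
      div_mul_cancel₀ _ (mul_pos h1 h2).ne'
    have hαC : (α : ℂ) * ((1 - z₀.re : ℝ) * (1 + u.re : ℝ)) = z₀.im * u.im := by
      exact_mod_cast hαeq
    have hne : ((1 - z₀.re : ℝ) : ℂ) * (1 + u.re : ℝ) ≠ 0 := by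
      exact_mod_cast (mul_pos h1 h2).ne'
    have hmain : (1 + z₀) * (1 - u) = α * ((1 - z₀) * (1 + u)) := by
      refine mul_right_cancel₀ hne ?_
      calc (1 + z₀) * (1 - u) * (((1 - z₀.re : ℝ) : ℂ) * (1 + u.re : ℝ))
          = ((1 + z₀) * (1 - z₀.re : ℝ)) * ((1 - u) * (1 + u.re : ℝ)) := by ring
        _ = -(Complex.I * Complex.I) * (z₀.im * u.im) * ((1 - z₀) * (1 + u)) := by
            rw [hA, hB]; ring
        _ = _ := by rw [Complex.I_mul_I, ← hαC]; ring
    rw [hval z₀ hz₀.le, div_eq_iff (by rw [← hd z₀ hz₀.le]; exact hd0 z₀ hz₀.le)]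
    push_cast
    linear_combination hmain
  · rw [hval z hz.le, norm_div, div_eq_one_iff_eq
      (norm_ne_zero_iff.2 (by rw [← hd z hz.le]; exact hd0 z hz.le)), Complex.norm_def,
      Complex.norm_def, Complex.normSq_apply, Complex.normSq_apply]
    have h3 := re_sq_add_im_sq_of_norm_eq_one hz
    congr 1
    simp
    linear_combination 4 * α * h3

lemma exists_allpass {z₀ u : ℂ} (hz₀ : ‖z₀‖ = 1) (hu : ‖u‖ = 1) (h : z₀.im = 0 → u.im = 0) :
    ∃ f : RHInfRing, diskValue z₀ f = u ∧ ∀ z, ‖z‖ = 1 → ‖diskValue z f‖ = 1 := by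
  rcases lt_trichotomy (z₀.im * u.im) 0 with hlt | heq | hgt
  · obtain ⟨f, hf, hf1⟩ := exists_allpass_of_pos (u := -u) hz₀ (by rwa [norm_neg])
      (by rw [Complex.neg_im]; linarith)
    have hval (z : ℂ) (hz : ‖z‖ = 1) : diskValue z (-f : RHInfRing) = -diskValue z f := by
      rw [← diskEval_apply z hz.le, map_neg, diskEval_apply]
    refine ⟨-f, by rw [hval z₀ hz₀, hf, neg_neg], fun z hz ↦ by rw [hval z hz, norm_neg, hf1 z hz]⟩
  · have him : u.im = 0 := by
      rcases mul_eq_zero.1 heq with h0 | h0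
      · exact h h0
      · exact h0
    have hu' : u = (u.re : ℂ) := Complex.ext (by simp) (by simp [him])
    refine ⟨constTF u.re, ?_, fun z _ ↦ ?_⟩
    · exact (diskValue_C z₀ u.re).trans hu'.symm
    · rw [constTF, diskValue_C, ← hu', hu]
  · exact exists_allpass_of_pos hz₀ hu hgt

/-- The field of possible values of real-rational functions at `z`: real numbers when `z` is
real, and all complex numbers otherwise. -/
def valueField (z : ℂ) : Subfield ℂ where
  carrier := {c | z.im = 0 → c.im = 0}
  mul_mem' ha hb h := by simp [ha h, hb h]
  one_mem' _ := rfl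
  add_mem' ha hb h := by simp [ha h, hb h]
  zero_mem' _ := rfl
  neg_mem' ha h := by simp [ha h]
  inv_mem' _ ha h := by simp [ha h]

lemma ofReal_mem_valueField (z : ℂ) (r : ℝ) : (r : ℂ) ∈ valueField z := fun _ ↦ Complex.ofReal_im r

lemma conj_mem_valueField {z c : ℂ} (hc : c ∈ valueField z) :
    starRingEnd ℂ c ∈ valueField z := fun h ↦ by simp [hc h]

lemma diskValue_mem_valueField (z : ℂ) (f : RatFunc ℝ) : diskValue z f ∈ valueField z := by
  intro h
  rw [← Complex.conj_eq_iff_im] at h ⊢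
  rw [← diskValue_conj, h]

lemma exists_interpolant {z₀ c : ℂ} (hz₀ : ‖z₀‖ = 1) (hc : c ∈ valueField z₀) :
    ∃ f : RHInfRing, diskValue z₀ f = c ∧ ∀ z, ‖z‖ = 1 → ‖diskValue z f‖ = ‖c‖ := by
  rcases eq_or_ne c 0 with rfl | hc0
  · refine ⟨constTF 0, ?_, fun z _ ↦ ?_⟩ <;> rw [constTF, diskValue_C] <;> simp
  have hn : (‖c‖ : ℂ) ≠ 0 := by exact_mod_cast norm_ne_zero_iff.2 hc0
  obtain ⟨f, hf, hf1⟩ := exists_allpass (u := c / ‖c‖) hz₀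
    (by rw [norm_div, Complex.norm_real, norm_norm, div_self (norm_ne_zero_iff.2 hc0)])
    (div_mem hc (ofReal_mem_valueField z₀ ‖c‖))
  have hval (z : ℂ) (hz : ‖z‖ = 1) :
      diskValue z (constTF ‖c‖ * f : RHInfRing) = ‖c‖ * diskValue z f := by
    rw [← diskEval_apply z hz.le, map_mul, diskEval_constTF, diskEval_apply]
  refine ⟨constTF ‖c‖ * f, ?_, fun z hz ↦ ?_⟩
  · rw [hval z₀ hz₀, hf, mul_div_cancel₀ _ hn]
  · rw [hval z hz, norm_mul, hf1 z hz, Complex.norm_real, norm_norm, mul_one]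

lemma exists_vector_interpolant {n : ℕ} {z₀ : ℂ} {v : Fin n → ℂ} (hz₀ : ‖z₀‖ = 1)
    (hv : ∀ i, v i ∈ valueField z₀) :
    ∃ a : Fin n → RHInfRing, (∀ i, diskValue z₀ (a i) = v i) ∧
      ∀ z, ‖z‖ = 1 → ‖WithLp.toLp 2 fun i ↦ diskValue z (a i)‖ = ‖WithLp.toLp 2 v‖ := by
  choose a ha ha1 using fun i ↦ exists_interpolant hz₀ (hv i)
  refine ⟨a, ha, fun z hz ↦ ?_⟩
  simp [EuclideanSpace.norm_eq, ha1 _ z hz]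

/-- A stable function whose modulus on the circle peaks exactly at a prescribed conjugate pair. -/
lemma exists_peak {z₀ : ℂ} (hz₀ : ‖z₀‖ = 1) :
    ∃ f : RHInfRing, ‖diskValue z₀ f‖ = 1 ∧ ∀ z, ‖z‖ = 1 → ‖diskValue z f‖ ≤ 1 ∧
      (‖diskValue z f‖ = 1 → z = z₀ ∨ z = starRingEnd ℂ z₀) := by
  obtain ⟨ζ, hζ⟩ := exists_diskValue_eq_self
  -- On the circle `z² - 2 Re(z₀) z + 1 = 2 z (Re z - Re z₀)`, so `f = z² (1 - (Re z - Re z₀)² /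
  -- 4)`. The factor `1 / 16` keeps the bracket in `[0, 1]`.
  set f : RHInfRing :=
    ζ ^ 2 - constTF (1 / 16) * (ζ ^ 2 - constTF (2 * z₀.re) * ζ + 1) ^ 2 with hf
  have hval (z : ℂ) (hz : ‖z‖ = 1) :
      diskValue z f = z ^ 2 * ((1 - (z.re - z₀.re) ^ 2 / 4 : ℝ) : ℂ) := by
    have h1 : z * starRingEnd ℂ z = 1 := by
      rw [Complex.mul_conj, Complex.normSq_eq_norm_sq, hz]; norm_num
    have h2 : z + starRingEnd ℂ z = 2 * z.re := by
      rw [Complex.add_conj]; push_cast; ring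
    have h3 : z ^ 2 - 2 * z₀.re * z + 1 = z * (2 * (z.re - z₀.re)) := by
      linear_combination z * h2 - h1
    rw [← diskEval_apply z hz.le, hf]
    simp only [map_sub, map_add, map_mul, map_pow, map_one, diskEval_constTF]
    rw [diskEval_apply, hζ z hz.le]
    push_cast
    rw [h3]
    ring
  have hre (z : ℂ) (hz : ‖z‖ = 1) : |z.re| ≤ 1 := hz ▸ Complex.abs_re_le_norm z
  have hnorm (z : ℂ) (hz : ‖z‖ = 1) : ‖diskValue z f‖ = 1 - (z.re - z₀.re) ^ 2 / 4 := by
    have h1 := abs_le.1 (hre z hz)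
    have h2 := abs_le.1 (hre z₀ hz₀)
    rw [hval z hz, norm_mul, norm_pow, hz, one_pow, one_mul, Complex.norm_real,
      Real.norm_of_nonneg]
    nlinarith
  refine ⟨f, by rw [hnorm z₀ hz₀]; simp, fun z hz ↦ ?_⟩
  rw [hnorm z hz]
  refine ⟨by linarith [sq_nonneg (z.re - z₀.re)], fun h ↦ ?_⟩
  have hre' : z.re = z₀.re := by
    have : (z.re - z₀.re) ^ 2 = 0 := by linarith
    exact sub_eq_zero.1 (pow_eq_zero_iff two_ne_zero |>.1 this)
  have h1 := re_sq_add_im_sq_of_norm_eq_one hz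
  have h2 := re_sq_add_im_sq_of_norm_eq_one hz₀
  have h3 : z.im * z.im = z₀.im * z₀.im := by rw [hre'] at h1; linarith
  rcases mul_self_eq_mul_self_iff.1 h3 with h4 | h4
  · exact Or.inl (Complex.ext hre' h4)
  · exact Or.inr (Complex.ext (by simpa using hre') (by simpa using h4))

end Interpolation

/-! ### Rank one matrices and real test vectors -/

section RankOne

open Matrix

variable {n : ℕ}

lemma star_dotProduct_self_eq_norm_sq (x : Fin n → ℂ) :
    star x ⬝ᵥ x = ((‖WithLp.toLp 2 x‖ ^ 2 : ℝ) : ℂ) := by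
  rw [EuclideanSpace.norm_sq_eq, dotProduct]
  push_cast
  refine Finset.sum_congr rfl fun i _ ↦ ?_
  rw [Pi.star_apply, RCLike.star_def, ← Complex.normSq_eq_conj_mul_self, Complex.normSq_eq_norm_sq]
  push_cast
  rfl

lemma norm_star_dotProduct_le (x y : Fin n → ℂ) :
    ‖star x ⬝ᵥ y‖ ≤ ‖WithLp.toLp 2 x‖ * ‖WithLp.toLp 2 y‖ := by
  have := norm_inner_le_norm (𝕜 := ℂ) (WithLp.toLp 2 x) (WithLp.toLp 2 y)
  rwa [EuclideanSpace.inner_toLp_toLp, dotProduct_comm] at this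

lemma norm_toLp_star (x : Fin n → ℂ) : ‖WithLp.toLp 2 (star x)‖ = ‖WithLp.toLp 2 x‖ := by
  simp [EuclideanSpace.norm_eq]

lemma norm_dotProduct_le (x y : Fin n → ℂ) :
    ‖x ⬝ᵥ y‖ ≤ ‖WithLp.toLp 2 x‖ * ‖WithLp.toLp 2 y‖ := by
  simpa [norm_toLp_star] using norm_star_dotProduct_le (star x) y

lemma vecMulVec_mulVec' (a b x : Fin n → ℂ) : vecMulVec a b *ᵥ x = (b ⬝ᵥ x) • a := by
  ext i
  simp [vecMulVec_mulVec, mul_comm]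

lemma exists_norm_mulVec_ge (hn : 1 ≤ n) (A : Matrix (Fin n) (Fin n) ℂ) :
    ∃ x : Fin n → ℂ, x ≠ 0 ∧
      maxSingularValue A * ‖WithLp.toLp 2 x‖ ≤ ‖WithLp.toLp 2 (A *ᵥ x)‖ := by
  have : Nonempty (Fin n) := ⟨⟨0, hn⟩⟩
  set L := Matrix.toEuclideanCLM (n := Fin n) (𝕜 := ℂ) A
  obtain ⟨p, hp, hmax⟩ := (isCompact_sphere (0 : EuclideanSpace ℂ (Fin n)) 1).exists_isMaxOn
    (NormedSpace.sphere_nonempty.2 zero_le_one) (f := fun x ↦ ‖L x‖) (by fun_prop)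
  have hp1 : ‖p‖ = 1 := by simpa using hp
  have hle : maxSingularValue A ≤ ‖L p‖ := by
    refine ContinuousLinearMap.opNorm_le_of_unit_norm (norm_nonneg _) fun x hx ↦ ?_
    exact hmax (show x ∈ Metric.sphere (0 : EuclideanSpace ℂ (Fin n)) 1 by simpa using hx)
  refine ⟨p.ofLp, fun h ↦ ?_, ?_⟩
  · have : p = 0 := by ext i; simp [h]
    simp [this] at hp1
  · change maxSingularValue A * ‖p‖ ≤ ‖L p‖
    rwa [hp1, mul_one]

/-- The cross terms are purely imaginary, so no symmetry is needed. For real `M`, a nonpositive form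
at `x` is thus nonpositive at one of its nonzero real or imaginary parts. -/
lemma re_form_eq_add_of_real {M : Matrix (Fin n) (Fin n) ℂ} (hM : ∀ i j, (M i j).im = 0)
    (x : Fin n → ℂ) : (star x ⬝ᵥ (M *ᵥ x)).re =
      (star (fun i ↦ ((x i).re : ℂ)) ⬝ᵥ (M *ᵥ fun i ↦ ((x i).re : ℂ))).re +
      (star (fun i ↦ ((x i).im : ℂ)) ⬝ᵥ (M *ᵥ fun i ↦ ((x i).im : ℂ))).re := by
  simp only [dotProduct, mulVec, Finset.mul_sum, Complex.re_sum, ← Finset.sum_add_distrib]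
  refine Finset.sum_congr rfl fun i _ ↦ Finset.sum_congr rfl fun j _ ↦ ?_
  simp [hM i j]

/-- A matrix over the value field with a nonpositive form value has a test vector over the value
field. -/
lemma exists_test_vector {z₀ : ℂ} {M : Matrix (Fin n) (Fin n) ℂ}
    (hM : ∀ i j, M i j ∈ valueField z₀) {x : Fin n → ℂ} (hx : x ≠ 0)
    (hform : (star x ⬝ᵥ (M *ᵥ x)).re ≤ 0) :
    ∃ y : Fin n → ℂ, y ≠ 0 ∧ (∀ i, y i ∈ valueField z₀) ∧ (star y ⬝ᵥ (M *ᵥ y)).re ≤ 0 := by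
  by_cases hz : z₀.im = 0
  · rw [re_form_eq_add_of_real (fun i j ↦ hM i j hz)] at hform
    by_cases hu : (fun i ↦ ((x i).re : ℂ)) = 0
    · refine ⟨fun i ↦ ((x i).im : ℂ), fun hv ↦ hx ?_, fun i ↦ ofReal_mem_valueField _ _, ?_⟩
      · ext i
        refine Complex.ext ?_ ?_
        · simpa using congrFun hu i
        · simpa using congrFun hv i
      · simpa [hu] using hform
    · rcases le_total (star (fun i ↦ ((x i).re : ℂ)) ⬝ᵥ (M *ᵥ fun i ↦ ((x i).re : ℂ))).re 0
        with h | h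
      · exact ⟨_, hu, fun i ↦ ofReal_mem_valueField _ _, h⟩
      · by_cases hv : (fun i ↦ ((x i).im : ℂ)) = 0
        · refine ⟨_, hu, fun i ↦ ofReal_mem_valueField _ _, ?_⟩
          simpa [hv] using hform
        · exact ⟨_, hv, fun i ↦ ofReal_mem_valueField _ _, by linarith⟩
  · exact ⟨x, hx, fun i h ↦ absurd h hz, hform⟩

lemma mulVec_mem_valueField {z₀ : ℂ} {M : Matrix (Fin n) (Fin n) ℂ}
    (hM : ∀ i j, M i j ∈ valueField z₀) {x : Fin n → ℂ} (hx : ∀ i, x i ∈ valueField z₀) (i : Fin n) :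
    (M *ᵥ x) i ∈ valueField z₀ :=
  sum_mem fun j _ ↦ mul_mem (hM i j) (hx j)

end RankOne

/-! ### Necessity of the gain condition -/

section GainNecessity

open Matrix

/-- With `u = A x` and `‖x‖ ≤ γ ‖u‖`, the matrix `P = g a bᵀ` is chosen so that `P(z₀) = -x u* /
‖u‖²`. Then `(1 + A P(z₀)) u = u - A x = 0`, and constant norms of `a` and `b` on the circle carry
the bound by `|g|` to all frequencies. -/
lemma exists_destabilizing_of_gain {n : ℕ} (hn : 1 ≤ n) {C : Matrix (Fin n) (Fin n) (RatFunc ℝ)}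
    (hC : IsStableTM C) {g : RatFunc ℝ} (hg : g ∈ RHInf) {z₀ : ℂ} (hz₀ : ‖z₀‖ = 1)
    (hg0 : diskValue z₀ g ≠ 0)
    (hgain : ‖diskValue z₀ g‖⁻¹ ≤ maxSingularValue (C.map (diskValue z₀))) :
    ∃ P : Matrix (Fin n) (Fin n) (RatFunc ℝ), IsStableTM P ∧
      (∀ z, ‖z‖ = 1 → maxSingularValue (P.map (diskValue z)) ≤ ‖diskValue z g‖) ∧
      ¬ FeedbackStable P C := by
  set A := C.map (diskValue z₀) with hA
  set γ := ‖diskValue z₀ g‖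
  have hγ : 0 < γ := norm_pos_iff.2 hg0
  have hAK (i j) : A i j ∈ valueField z₀ := diskValue_mem_valueField z₀ _
  obtain ⟨x', hx', hx'A⟩ := exists_norm_mulVec_ge hn A
  -- Writing `‖x‖ ≤ γ ‖A x‖` as a nonpositive form allows `exists_test_vector` to supply a real `x`
  -- when `z₀` is real.
  have hAH (x : Fin n → ℂ) : star x ⬝ᵥ ((1 - ((γ ^ 2 : ℝ) : ℂ) • (Aᴴ * A)) *ᵥ x) =
      ((‖WithLp.toLp 2 x‖ ^ 2 - γ ^ 2 * ‖WithLp.toLp 2 (A *ᵥ x)‖ ^ 2 : ℝ) : ℂ) := by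
    rw [sub_mulVec, one_mulVec, smul_mulVec, dotProduct_sub, dotProduct_smul, ← mulVec_mulVec,
      dotProduct_mulVec, ← star_mulVec, star_dotProduct_self_eq_norm_sq,
      star_dotProduct_self_eq_norm_sq, smul_eq_mul]
    push_cast
    ring
  have hMK (i j) : (1 - ((γ ^ 2 : ℝ) : ℂ) • (Aᴴ * A)) i j ∈ valueField z₀ := by
    rw [Matrix.sub_apply, Matrix.smul_apply, smul_eq_mul, Matrix.one_apply]
    refine sub_mem (by split_ifs; exacts [one_mem _, zero_mem _])
      (mul_mem (ofReal_mem_valueField _ _) (sum_mem fun k _ ↦ mul_mem ?_ (hAK k j)))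
    exact conj_mem_valueField (hAK k i)
  obtain ⟨x, hx, hxK, hxform⟩ := exists_test_vector hMK hx' (by
    rw [hAH, Complex.ofReal_re, sub_nonpos, ← mul_pow]
    refine pow_le_pow_left₀ (norm_nonneg _) ?_ 2
    calc ‖WithLp.toLp 2 x'‖ = γ * (γ⁻¹ * ‖WithLp.toLp 2 x'‖) := by
          rw [mul_inv_cancel_left₀ hγ.ne']
      _ ≤ γ * ‖WithLp.toLp 2 (A *ᵥ x')‖ := by
          refine mul_le_mul_of_nonneg_left (le_trans ?_ hx'A) hγ.le
          exact mul_le_mul_of_nonneg_right hgain (norm_nonneg _))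
  set u := A *ᵥ x with hu
  have hxu : ‖WithLp.toLp 2 x‖ ≤ γ * ‖WithLp.toLp 2 u‖ := by
    rw [hAH, Complex.ofReal_re, sub_nonpos, ← mul_pow] at hxform
    exact (pow_le_pow_iff_left₀ (norm_nonneg _) (by positivity) two_ne_zero).1 hxform
  have hxn : 0 < ‖WithLp.toLp 2 x‖ := norm_pos_iff.2 (by simpa using hx)
  have hun : 0 < ‖WithLp.toLp 2 u‖ := pos_of_mul_pos_right (hxn.trans_le hxu) hγ.le
  have hu0 : u ≠ 0 := fun h ↦ by simp [h] at hun
  have hunC : ((‖WithLp.toLp 2 u‖ ^ 2 : ℝ) : ℂ) ≠ 0 := by exact_mod_cast (pow_pos hun 2).ne'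
  obtain ⟨a, ha, ha1⟩ := exists_vector_interpolant (v := (-(diskValue z₀ g)⁻¹) • x) hz₀ fun i ↦
    mul_mem (neg_mem (inv_mem (diskValue_mem_valueField _ _))) (hxK i)
  obtain ⟨b, hb, hb1⟩ := exists_vector_interpolant
    (v := (((‖WithLp.toLp 2 u‖ ^ 2 : ℝ) : ℂ)⁻¹) • star u) hz₀ fun i ↦
    mul_mem (inv_mem (ofReal_mem_valueField _ _))
      (conj_mem_valueField (mulVec_mem_valueField hAK hxK i))
  have hval (z : ℂ) (hz : ‖z‖ ≤ 1) :
      (Matrix.of fun i j ↦ g * (a i : RatFunc ℝ) * (b j : RatFunc ℝ)).map (diskValue z) =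
      diskValue z g • vecMulVec (fun i ↦ diskValue z (a i)) (fun j ↦ diskValue z (b j)) := by
    ext i j
    simp only [map_apply, of_apply, Matrix.smul_apply, vecMulVec_apply, smul_eq_mul]
    rw [diskValue_mul (mul_mem_RHInf hg (a i).2) (b j).2 hz, diskValue_mul hg (a i).2 hz, mul_assoc]
  have hP : IsStableTM (Matrix.of fun i j ↦ g * (a i : RatFunc ℝ) * (b j : RatFunc ℝ)) :=
    fun i j ↦ mul_mem_RHInf (mul_mem_RHInf hg (a i).2) (b j).2
  refine ⟨_, hP, fun z hz ↦ ?_, fun hstab ↦ ?_⟩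
  · rw [hval z hz.le]
    refine maxSingularValue_le (norm_nonneg _) fun y ↦ ?_
    rw [smul_mulVec, vecMulVec_mulVec', WithLp.toLp_smul, WithLp.toLp_smul, norm_smul, norm_smul,
      ha1 z hz]
    refine mul_le_mul_of_nonneg_left ?_ (norm_nonneg _)
    have h1 := norm_dotProduct_le (fun j ↦ diskValue z (b j)) y
    rw [hb1 z hz] at h1
    have h2 : ‖WithLp.toLp 2 ((((‖WithLp.toLp 2 u‖ ^ 2 : ℝ) : ℂ)⁻¹) • star u)‖ =
        ‖WithLp.toLp 2 u‖⁻¹ := by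
      rw [WithLp.toLp_smul, norm_smul, norm_toLp_star, norm_inv, Complex.norm_real,
        Real.norm_of_nonneg (by positivity)]
      field_simp
    have h3 : ‖WithLp.toLp 2 ((-(diskValue z₀ g)⁻¹) • x)‖ = γ⁻¹ * ‖WithLp.toLp 2 x‖ := by
      rw [WithLp.toLp_smul, norm_smul, norm_neg, norm_inv]
    rw [h2] at h1
    rw [h3]
    calc _ ≤ (‖WithLp.toLp 2 u‖⁻¹ * ‖WithLp.toLp 2 y‖) * (γ⁻¹ * (γ * ‖WithLp.toLp 2 u‖)) := by
          gcongr
      _ = _ := by field_simp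
  · refine (feedbackStable_iff hP hC).1 hstab z₀ hz₀.le (exists_mulVec_eq_zero_iff.1 ⟨u, hu0, ?_⟩)
    rw [hval z₀ hz₀.le, funext ha, funext hb, add_mulVec, one_mulVec, ← mulVec_mulVec, smul_mulVec,
      vecMulVec_mulVec', smul_dotProduct, star_dotProduct_self_eq_norm_sq, smul_eq_mul,
      inv_mul_cancel₀ hunC, one_smul, smul_smul, mul_neg, mul_inv_cancel₀ hg0, neg_one_smul,
      mulVec_neg]
    exact add_neg_cancel u

end GainNecessity

/-! ### Cayley transforms of rank one contractions -/

section PhaseNecessity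

open Matrix

variable {n : ℕ}

/-- The form of the matrix lies in the closed right half plane without zero, and meets the imaginary
axis on one side of the origin only. -/
def IsQuasiAccretive (B : Matrix (Fin n) (Fin n) ℂ) : Prop :=
  ∃ ε : ℝ, (ε = 1 ∨ ε = -1) ∧ (∀ x : Fin n → ℂ, 0 ≤ (star x ⬝ᵥ (B *ᵥ x)).re) ∧
    ∀ x : Fin n → ℂ, x ≠ 0 → (star x ⬝ᵥ (B *ᵥ x)).re = 0 → 0 < ε * (star x ⬝ᵥ (B *ᵥ x)).im

lemma IsQuasiAccretive.map_conj {B : Matrix (Fin n) (Fin n) ℂ} (hB : IsQuasiAccretive B) :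
    IsQuasiAccretive (B.map (starRingEnd ℂ)) := by
  have key (x : Fin n → ℂ) : star x ⬝ᵥ (B.map (starRingEnd ℂ) *ᵥ x) =
      starRingEnd ℂ (star (star x) ⬝ᵥ (B *ᵥ star x)) := by
    simp [dotProduct, mulVec]
  obtain ⟨ε, hε, h0, h1⟩ := hB
  refine ⟨-ε, by rcases hε with rfl | rfl <;> simp, fun x ↦ ?_, fun x hx hre ↦ ?_⟩
  · rw [key, Complex.conj_re]
    exact h0 _
  · rw [key, Complex.conj_re] at hre
    rw [key, Complex.conj_im, neg_mul_neg]
    exact h1 _ (star_ne_zero.2 hx) hre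

/-- `(1 - S) (1 + S)⁻¹` for the rank one matrix `S = a bᵀ`. -/
noncomputable def rankOneCayley (a b : Fin n → ℂ) : Matrix (Fin n) (Fin n) ℂ :=
  1 - (2 * (1 + b ⬝ᵥ a)⁻¹) • vecMulVec a b

lemma rankOneCayley_mulVec (a b x : Fin n → ℂ) :
    rankOneCayley a b *ᵥ x = x - (2 * (1 + b ⬝ᵥ a)⁻¹ * (b ⬝ᵥ x)) • a := by
  rw [rankOneCayley, sub_mulVec, one_mulVec, smul_mulVec, vecMulVec_mulVec', smul_smul]

/-- The vector is `v = (1 + S)⁻¹ x`, by the Sherman–Morrison formula. In terms of `v` the real part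
of the form is `‖v‖² - ‖S v‖²`, so contractivity of `S` becomes accretivity. -/
lemma rankOneCayley_decomp {a b : Fin n → ℂ} (hk : 1 + b ⬝ᵥ a ≠ 0) (x : Fin n → ℂ) :
    ∃ v : Fin n → ℂ, x = v + (b ⬝ᵥ v) • a ∧ rankOneCayley a b *ᵥ x = v - (b ⬝ᵥ v) • a := by
  set v := x - ((1 + b ⬝ᵥ a)⁻¹ * (b ⬝ᵥ x)) • a with hv
  have hbv : b ⬝ᵥ v = (1 + b ⬝ᵥ a)⁻¹ * (b ⬝ᵥ x) := by
    rw [hv, dotProduct_sub, dotProduct_smul, smul_eq_mul]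
    field_simp
    ring
  refine ⟨v, by rw [hbv, hv, sub_add_cancel], ?_⟩
  rw [hbv, rankOneCayley_mulVec, hv, sub_sub, ← add_smul]
  congr 2
  ring

lemma re_form_decomp (v a : Fin n → ℂ) (t : ℂ) :
    (star (v + t • a) ⬝ᵥ (v - t • a)).re =
      ‖WithLp.toLp 2 v‖ ^ 2 - (‖t‖ * ‖WithLp.toLp 2 a‖) ^ 2 := by
  have h1 : star (t • a) ⬝ᵥ v = starRingEnd ℂ (star v ⬝ᵥ (t • a)) := by
    rw [star_dotProduct]; rfl
  have h2 : ‖WithLp.toLp 2 (t • a)‖ = ‖t‖ * ‖WithLp.toLp 2 a‖ := by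
    rw [WithLp.toLp_smul, norm_smul]
  rw [star_add, add_dotProduct, dotProduct_sub, dotProduct_sub, h1,
    star_dotProduct_self_eq_norm_sq, star_dotProduct_self_eq_norm_sq, h2, Complex.add_re,
    Complex.sub_re, Complex.sub_re, Complex.conj_re, Complex.ofReal_re, Complex.ofReal_re]
  ring

lemma re_form_rankOneCayley_nonneg {a b : Fin n → ℂ} (hk : 1 + b ⬝ᵥ a ≠ 0)
    (hab : ‖WithLp.toLp 2 a‖ * ‖WithLp.toLp 2 b‖ ≤ 1) (x : Fin n → ℂ) :
    0 ≤ (star x ⬝ᵥ (rankOneCayley a b *ᵥ x)).re := by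
  obtain ⟨v, hx, hQ⟩ := rankOneCayley_decomp hk x
  rw [hQ]
  conv_rhs => rw [hx]
  rw [re_form_decomp, sub_nonneg]
  refine pow_le_pow_left₀ (by positivity) ?_ 2
  have h1 := norm_dotProduct_le b v
  calc ‖b ⬝ᵥ v‖ * ‖WithLp.toLp 2 a‖ ≤ ‖WithLp.toLp 2 b‖ * ‖WithLp.toLp 2 v‖ * ‖WithLp.toLp 2 a‖ :=
        mul_le_mul_of_nonneg_right h1 (norm_nonneg _)
    _ = (‖WithLp.toLp 2 a‖ * ‖WithLp.toLp 2 b‖) * ‖WithLp.toLp 2 v‖ := by ring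
    _ ≤ ‖WithLp.toLp 2 v‖ := mul_le_of_le_one_left (norm_nonneg _) hab

lemma isQuasiAccretive_rankOneCayley_of_lt {a b : Fin n → ℂ} (hk : 1 + b ⬝ᵥ a ≠ 0)
    (hab : ‖WithLp.toLp 2 a‖ * ‖WithLp.toLp 2 b‖ < 1) : IsQuasiAccretive (rankOneCayley a b) := by
  refine ⟨1, Or.inl rfl, re_form_rankOneCayley_nonneg hk hab.le, fun x hx hre ↦ ?_⟩
  obtain ⟨v, hxv, hQ⟩ := rankOneCayley_decomp hk x
  rw [hQ] at hre
  nth_rewrite 1 [hxv] at hre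
  rw [re_form_decomp, sub_eq_zero] at hre
  have h2 : ‖WithLp.toLp 2 v‖ = ‖b ⬝ᵥ v‖ * ‖WithLp.toLp 2 a‖ :=
    (pow_left_inj₀ (norm_nonneg _) (by positivity) two_ne_zero).1 hre
  have h1 := norm_dotProduct_le b v
  have hv : ‖WithLp.toLp 2 v‖ = 0 := by
    by_contra h0
    have hpos : 0 < ‖WithLp.toLp 2 v‖ := lt_of_le_of_ne (norm_nonneg _) (Ne.symm h0)
    have h3 : ‖WithLp.toLp 2 v‖ ≤
        (‖WithLp.toLp 2 a‖ * ‖WithLp.toLp 2 b‖) * ‖WithLp.toLp 2 v‖ := by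
      calc ‖WithLp.toLp 2 v‖ = ‖b ⬝ᵥ v‖ * ‖WithLp.toLp 2 a‖ := h2
        _ ≤ ‖WithLp.toLp 2 b‖ * ‖WithLp.toLp 2 v‖ * ‖WithLp.toLp 2 a‖ :=
          mul_le_mul_of_nonneg_right h1 (norm_nonneg _)
        _ = _ := by ring
    nlinarith
  have hv0 : v = 0 := by simpa using hv
  exact absurd (by rw [hxv, hv0]; simp) hx

/-- Boundary case: `S = w' w* / ‖w‖²`, for `w + w' = y` and `w' - w = x`. -/
lemma isQuasiAccretive_rankOneCayley_of_eq {x y w w' b : Fin n → ℂ} (hw : w ≠ 0)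
    (hb : b = (((‖WithLp.toLp 2 w‖ ^ 2 : ℝ) : ℂ)⁻¹) • star w) (hk : 1 + b ⬝ᵥ w' ≠ 0)
    (hww : ‖WithLp.toLp 2 w'‖ ≤ ‖WithLp.toLp 2 w‖) (hy : w + w' = y) (hx : w' - w = x)
    (hxy : star x ⬝ᵥ y ≠ 0) : IsQuasiAccretive (rankOneCayley w' b) := by
  have hwn : 0 < ‖WithLp.toLp 2 w‖ := norm_pos_iff.2 (by simpa using hw)
  have hbn : ‖WithLp.toLp 2 b‖ = ‖WithLp.toLp 2 w‖⁻¹ := by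
    rw [hb, WithLp.toLp_smul, norm_smul, norm_toLp_star, norm_inv, Complex.norm_real,
      Real.norm_of_nonneg (by positivity)]
    field_simp
  have hab : ‖WithLp.toLp 2 w'‖ * ‖WithLp.toLp 2 b‖ ≤ 1 := by
    rw [hbn, ← div_eq_mul_inv]
    exact (div_le_one hwn).2 hww
  have hform (p : Fin n → ℂ) (hp : p ≠ 0)
      (hre : (star p ⬝ᵥ (rankOneCayley w' b *ᵥ p)).re = 0) :
      ∃ c : ℂ, c ≠ 0 ∧ star p ⬝ᵥ (rankOneCayley w' b *ᵥ p) =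
        -(((‖c‖ ^ 2 : ℝ) : ℂ) * starRingEnd ℂ (star x ⬝ᵥ y)) := by
    obtain ⟨v, hpv, hQ⟩ := rankOneCayley_decomp hk p
    set c := b ⬝ᵥ v with hc
    have hre' := hre
    rw [hQ] at hre'
    nth_rewrite 1 [hpv] at hre'
    rw [re_form_decomp, sub_eq_zero] at hre'
    have h2 : ‖WithLp.toLp 2 v‖ = ‖c‖ * ‖WithLp.toLp 2 w'‖ :=
      (pow_left_inj₀ (norm_nonneg _) (by positivity) two_ne_zero).1 hre'
    -- Equality in Cauchy–Schwarz: `c • w` is the orthogonal projection of `v` on `w`, while `‖v‖ =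
    -- |c| ‖w'‖ ≤ |c| ‖w‖`, so the residual vanishes. The real part of the form is therefore zero
    -- only on multiples of `y`.
    have hvc : v = c • w := by
      have h3 : ‖WithLp.toLp 2 (v - c • w)‖ ^ 2 =
          ‖WithLp.toLp 2 v‖ ^ 2 - (‖c‖ * ‖WithLp.toLp 2 w‖) ^ 2 := by
        have hwv : star w ⬝ᵥ v = ((‖WithLp.toLp 2 w‖ ^ 2 : ℝ) : ℂ) * c := by
          rw [hc, hb, smul_dotProduct, smul_eq_mul, mul_inv_cancel_left₀]
          exact_mod_cast (pow_pos hwn 2).ne'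
        have hvw : star v ⬝ᵥ w = starRingEnd ℂ (star w ⬝ᵥ v) := by
          rw [star_dotProduct]; rfl
        have h4 : ((‖WithLp.toLp 2 (v - c • w)‖ ^ 2 : ℝ) : ℂ) =
            ((‖WithLp.toLp 2 v‖ ^ 2 - (‖c‖ * ‖WithLp.toLp 2 w‖) ^ 2 : ℝ) : ℂ) := by
          have hcc : starRingEnd ℂ c * c = ((‖c‖ ^ 2 : ℝ) : ℂ) := by
            rw [← Complex.normSq_eq_conj_mul_self, Complex.normSq_eq_norm_sq]
          rw [← star_dotProduct_self_eq_norm_sq, star_sub, sub_dotProduct, dotProduct_sub,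
            dotProduct_sub, star_smul, smul_dotProduct, smul_dotProduct, dotProduct_smul,
            dotProduct_smul, hvw, hwv, star_dotProduct_self_eq_norm_sq,
            star_dotProduct_self_eq_norm_sq]
          simp only [smul_eq_mul, RCLike.star_def, map_mul, Complex.conj_ofReal]
          push_cast at hcc ⊢
          linear_combination (-(‖WithLp.toLp 2 w‖ : ℂ) ^ 2) * hcc
        exact_mod_cast h4
      have h5 : ‖WithLp.toLp 2 (v - c • w)‖ ^ 2 ≤ 0 := by
        rw [h3, h2, sub_nonpos]
        exact pow_le_pow_left₀ (by positivity)
          (mul_le_mul_of_nonneg_left hww (norm_nonneg _)) 2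
      have h6 : ‖WithLp.toLp 2 (v - c • w)‖ = 0 :=
        pow_eq_zero_iff two_ne_zero |>.1 (h5.antisymm (sq_nonneg _))
      have h7 : v - c • w = 0 := (WithLp.toLp_eq_zero 2).1 (norm_eq_zero.1 h6)
      exact sub_eq_zero.1 h7
    have hpc : p = c • y := by rw [hpv, hvc, ← smul_add, hy]
    have hQc : rankOneCayley w' b *ᵥ p = -(c • x) := by
      rw [hQ, hvc, ← hx, smul_sub, neg_sub]
    refine ⟨c, fun h ↦ hp (by rw [hpc, h, zero_smul]), ?_⟩
    have hyx : star y ⬝ᵥ x = starRingEnd ℂ (star x ⬝ᵥ y) := by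
      rw [star_dotProduct]; rfl
    rw [hQc, hpc, dotProduct_neg, star_smul, smul_dotProduct, dotProduct_smul, hyx, smul_eq_mul,
      smul_eq_mul, ← mul_assoc, RCLike.star_def, ← Complex.normSq_eq_conj_mul_self,
      Complex.normSq_eq_norm_sq]
  -- At `c • y` the form is `-|c|²` times the conjugate of `x*y`, so its imaginary part always has
  -- the sign of `Im x*y`.
  refine ⟨if 0 < (star x ⬝ᵥ y).im then 1 else -1, by split_ifs <;> simp,
    re_form_rankOneCayley_nonneg hk hab, fun p hp hre ↦ ?_⟩
  obtain ⟨c, hc, hcform⟩ := hform p hp hre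
  have hcn : 0 < ‖c‖ ^ 2 := pow_pos (norm_pos_iff.2 hc) 2
  rw [hcform, Complex.neg_re, Complex.re_ofReal_mul, Complex.conj_re, neg_eq_zero,
    mul_eq_zero] at hre
  have hre0 : (star x ⬝ᵥ y).re = 0 := hre.resolve_left hcn.ne'
  have him : (star x ⬝ᵥ y).im ≠ 0 := fun h ↦ hxy (Complex.ext hre0 h)
  rw [hcform, Complex.neg_im, Complex.im_ofReal_mul, Complex.conj_im]
  simp only [mul_neg, neg_neg]
  split_ifs with hpos
  · nlinarith
  · have : (star x ⬝ᵥ y).im < 0 := lt_of_le_of_ne (not_lt.1 hpos) him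
    nlinarith

end PhaseNecessity

/-! ### Necessity of the phase condition -/

section PhaseDestabilization

open Matrix

lemma map_diskValue_smul {n : ℕ} {Q : Matrix (Fin n) (Fin n) (RatFunc ℝ)} (hQ : IsStableTM Q)
    {h : RatFunc ℝ} (hh : h ∈ RHInf) {z : ℂ} (hz : ‖z‖ ≤ 1) :
    (h • Q).map (diskValue z) = diskValue z h • Q.map (diskValue z) := by
  ext i j
  exact diskValue_mul hh (hQ i j) hz

/-- A scalar stable function bounded by one on the circle, and avoiding `-1` there, avoids `-1` in
the whole closed disk. -/
lemma one_add_diskValue_ne_zero (σ : RHInfRing) (h1 : ∀ z, ‖z‖ = 1 → ‖diskValue z σ‖ ≤ 1)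
    (h2 : ∀ z, ‖z‖ = 1 → 1 + diskValue z σ ≠ 0) {z : ℂ} (hz : ‖z‖ ≤ 1) :
    1 + diskValue z σ ≠ 0 := by
  have := ne_zero_of_homotopy (F := fun τ z ↦ 1 + (τ : ℂ) * diskValue z σ) ?_ ?_ ?_ (by simp) hz
  · simpa using this
  · exact continuousOn_const.add
      ((by fun_prop : Continuous fun p : ℝ × ℂ ↦ (p.1 : ℂ)).continuousOn.mul
        ((continuousOn_diskValue σ.2).comp continuousOn_snd fun p hp ↦ hp.2))
  · exact fun τ _ ↦ ((differentiableOn_diskValue σ.2).const_mul _).const_add _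
  · intro τ hτ z hz h0
    rcases hτ.2.eq_or_lt with rfl | hlt
    · exact h2 z hz (by simpa using h0)
    · have h3 : ‖(τ : ℂ) * diskValue z σ‖ = 1 := by
        rw [eq_neg_of_add_eq_zero_right h0, norm_neg, norm_one]
      rw [norm_mul, Complex.norm_real, Real.norm_of_nonneg hτ.1] at h3
      nlinarith [h1 z hz, norm_nonneg (diskValue z σ), hτ.1]

lemma diskValue_sum_mul {n : ℕ} (b a : Fin n → RHInfRing) {z : ℂ} (hz : ‖z‖ ≤ 1) :
    diskValue z (∑ i, b i * a i : RHInfRing) =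
      (fun i ↦ diskValue z (b i)) ⬝ᵥ fun i ↦ diskValue z (a i) := by
  rw [← diskEval_apply z hz, map_sum, dotProduct]
  exact Finset.sum_congr rfl fun i _ ↦ map_mul _ _ _

/-- The only division is by `1 + bᵀa`, which the hypothesis makes a unit among the stable functions.
-/
lemma exists_rankOneCayley {n : ℕ} (a b : Fin n → RHInfRing)
    (hk : ∀ z : ℂ, ‖z‖ ≤ 1 → 1 + diskValue z (∑ i, b i * a i : RHInfRing) ≠ 0) :
    ∃ Q : Matrix (Fin n) (Fin n) (RatFunc ℝ), IsStableTM Q ∧ ∀ z : ℂ, ‖z‖ ≤ 1 →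
      Q.map (diskValue z) =
        rankOneCayley (fun i ↦ diskValue z (a i)) fun i ↦ diskValue z (b i) := by
  have hval (z : ℂ) (hz : ‖z‖ ≤ 1) : diskValue z (1 + ∑ i, b i * a i : RHInfRing) =
      1 + diskValue z (∑ i, b i * a i : RHInfRing) := by
    rw [← diskEval_apply z hz, map_add, map_one]; rfl
  obtain ⟨k, hkinv⟩ := exists_inverse_of_diskValue_ne_zero (1 + ∑ i, b i * a i)
    fun z hz ↦ by rw [hval z hz]; exact hk z hz
  refine ⟨(1 - (2 * k) • vecMulVec a b).map RHInfRing.subtype, isStableTM_map _, fun z hz ↦ ?_⟩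
  have hkz : diskEval z hz k =
      (1 + (fun i ↦ diskValue z (b i)) ⬝ᵥ fun i ↦ diskValue z (a i))⁻¹ := by
    have := congrArg (diskEval z hz) hkinv
    rw [map_mul, map_one, diskEval_apply, hval z hz, diskValue_sum_mul b a hz] at this
    exact eq_inv_of_mul_eq_one_right this
  rw [map_diskValue_map_subtype _ hz, rankOneCayley, ← hkz]
  ext i j
  simp only [map_apply, Matrix.sub_apply, Matrix.smul_apply, smul_eq_mul, vecMulVec_apply, map_sub,
    map_mul, Matrix.one_apply, map_ofNat, diskEval_apply]
  congr 1
  split_ifs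
  exacts [map_one (diskEval z hz), map_zero (diskEval z hz)]

lemma exists_destabilizing_of_phase {n : ℕ} {C : Matrix (Fin n) (Fin n) (RatFunc ℝ)}
    (hC : IsStableTM C) {h : RatFunc ℝ} (hh : h ∈ RHInf) {z₀ : ℂ} (hz₀ : ‖z₀‖ = 1)
    (hh0 : diskValue z₀ h ≠ 0)
    (hsec : ∀ x : Fin n → ℂ, x ≠ 0 → star x ⬝ᵥ (C.map (diskValue z₀) *ᵥ x) ≠ 0)
    {x' : Fin n → ℂ} (hx' : x' ≠ 0)
    (hform : (diskValue z₀ h * (star x' ⬝ᵥ (C.map (diskValue z₀) *ᵥ x'))).re ≤ 0) :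
    ∃ Q : Matrix (Fin n) (Fin n) (RatFunc ℝ), IsStableTM Q ∧
      (∀ z, ‖z‖ = 1 → IsQuasiAccretive (Q.map (diskValue z))) ∧ ¬ FeedbackStable (h • Q) C := by
  set A := diskValue z₀ h • C.map (diskValue z₀) with hA
  have hAK (i j) : A i j ∈ valueField z₀ :=
    mul_mem (diskValue_mem_valueField z₀ _) (diskValue_mem_valueField z₀ _)
  have hAform (x : Fin n → ℂ) : star x ⬝ᵥ (A *ᵥ x) =
      diskValue z₀ h * (star x ⬝ᵥ (C.map (diskValue z₀) *ᵥ x)) := by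
    rw [hA, smul_mulVec, dotProduct_smul, smul_eq_mul]
  obtain ⟨x, hx, hxK, hxre⟩ := exists_test_vector hAK hx' (by rwa [hAform])
  have hxA : star x ⬝ᵥ (A *ᵥ x) ≠ 0 := by
    rw [hAform]
    exact mul_ne_zero hh0 (hsec x hx)
  set y := A *ᵥ x with hy
  have hyK (i) : y i ∈ valueField z₀ := mulVec_mem_valueField hAK hxK i
  have hy0 : y ≠ 0 := fun h ↦ hxA (by rw [h, dotProduct_zero])
  -- A Cayley transform of `S` sends `w + S w` to `w - S w`; requiring `y ↦ -x` forces these `w` and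
  -- `w' = S w`.
  set w : Fin n → ℂ := ((1 / 2 : ℝ) : ℂ) • (y - x) with hw
  set w' : Fin n → ℂ := ((1 / 2 : ℝ) : ℂ) • (y + x) with hw'
  have hwK (i) : w i ∈ valueField z₀ :=
    mul_mem (ofReal_mem_valueField _ _) (sub_mem (hyK i) (hxK i))
  have hw'K (i) : w' i ∈ valueField z₀ :=
    mul_mem (ofReal_mem_valueField _ _) (add_mem (hyK i) (hxK i))
  have hwy : w + w' = y := by
    rw [hw, hw']; ext i; simp; ring
  have hwx : w' - w = x := by
    rw [hw, hw']; ext i; simp; ring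
  have hre : (star x ⬝ᵥ y).re = ‖WithLp.toLp 2 w'‖ ^ 2 - ‖WithLp.toLp 2 w‖ ^ 2 := by
    have h1 := re_form_decomp w' w (-1)
    rw [neg_one_smul, ← sub_eq_add_neg, sub_neg_eq_add, hwx, add_comm w', hwy, norm_neg, norm_one,
      one_mul] at h1
    exact h1
  have hww : ‖WithLp.toLp 2 w'‖ ≤ ‖WithLp.toLp 2 w‖ := by
    rw [hre, sub_nonpos] at hxre
    exact (pow_le_pow_iff_left₀ (norm_nonneg _) (norm_nonneg _) two_ne_zero).1 hxre
  have hw0 : w ≠ 0 := by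
    intro h0
    have h1 : w' = 0 := by simpa [h0] using hww
    exact hy0 (by rw [← hwy, h0, h1, add_zero])
  have hwn : 0 < ‖WithLp.toLp 2 w‖ := norm_pos_iff.2 (by simpa using hw0)
  have hwnC : ((‖WithLp.toLp 2 w‖ ^ 2 : ℝ) : ℂ) ≠ 0 := by exact_mod_cast (pow_pos hwn 2).ne'
  set bv : Fin n → ℂ := (((‖WithLp.toLp 2 w‖ ^ 2 : ℝ) : ℂ)⁻¹) • star w with hbv
  have hbvn : ‖WithLp.toLp 2 bv‖ = ‖WithLp.toLp 2 w‖⁻¹ := by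
    rw [hbv, WithLp.toLp_smul, norm_smul, norm_toLp_star, norm_inv, Complex.norm_real,
      Real.norm_of_nonneg (by positivity)]
    field_simp
  have hbw : bv ⬝ᵥ w = 1 := by
    rw [hbv, smul_dotProduct, star_dotProduct_self_eq_norm_sq, smul_eq_mul, inv_mul_cancel₀ hwnC]
  -- The left side is `w*y / ‖w‖²`. If it vanished, `‖y‖² = x*y` would have nonpositive real part,
  -- although `y ≠ 0`.
  have hk₀ : 1 + bv ⬝ᵥ w' ≠ 0 := by
    intro h0
    have h1 : star w ⬝ᵥ y = 0 := by
      rw [← hbw, ← dotProduct_add, hwy, hbv, smul_dotProduct, smul_eq_mul] at h0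
      exact (mul_eq_zero.1 h0).resolve_left (inv_ne_zero hwnC)
    have h2 : star y ⬝ᵥ y = star x ⬝ᵥ y := by
      have h3 : w = ((1 / 2 : ℝ) : ℂ) • (y - x) := hw
      rw [h3, star_smul, smul_dotProduct, star_sub, sub_dotProduct, smul_eq_zero] at h1
      exact sub_eq_zero.1 (h1.resolve_left (by simp))
    rw [← h2, star_dotProduct_self_eq_norm_sq, Complex.ofReal_re] at hxre
    have h4 : 0 < ‖WithLp.toLp 2 y‖ := norm_pos_iff.2 (by simpa using hy0)
    exact hxre.not_gt (pow_pos h4 2)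
  obtain ⟨ψ, hψ0, hψ⟩ := exists_peak hz₀
  have hψne : diskValue z₀ ψ ≠ 0 := norm_ne_zero_iff.1 (by rw [hψ0]; exact one_ne_zero)
  -- Dividing by `ψ(z₀)`, of modulus one, makes `a = ψ a'` equal `w'` at `z₀`; elsewhere `‖a‖ ‖b‖ ≤
  -- |ψ|`, which is less than `1` away from `z₀` and its conjugate.
  obtain ⟨a', ha', ha'n⟩ := exists_vector_interpolant (v := (diskValue z₀ ψ)⁻¹ • w') hz₀ fun i ↦
    mul_mem (inv_mem (diskValue_mem_valueField _ _)) (hw'K i)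
  obtain ⟨b, hb, hbn⟩ := exists_vector_interpolant (v := bv) hz₀ fun i ↦
    mul_mem (inv_mem (ofReal_mem_valueField _ _)) (conj_mem_valueField (hwK i))
  set a : Fin n → RHInfRing := fun i ↦ ψ * a' i
  have haval (z : ℂ) (hz : ‖z‖ = 1) : (fun i ↦ diskValue z (a i)) =
      diskValue z ψ • fun i ↦ diskValue z (a' i) := by
    funext i
    exact diskValue_mul ψ.2 (a' i).2 hz.le
  have ha₀ : (fun i ↦ diskValue z₀ (a i)) = w' := by
    rw [haval z₀ hz₀, funext ha', smul_inv_smul₀ hψne]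
  have hab (z : ℂ) (hz : ‖z‖ = 1) : ‖WithLp.toLp 2 fun i ↦ diskValue z (a i)‖ *
      ‖WithLp.toLp 2 fun i ↦ diskValue z (b i)‖ ≤ ‖diskValue z ψ‖ := by
    rw [haval z hz, WithLp.toLp_smul, norm_smul, ha'n z hz, hbn z hz, hbvn, WithLp.toLp_smul,
      norm_smul, norm_inv, hψ0, inv_one, one_mul, mul_assoc, ← div_eq_mul_inv]
    exact mul_le_of_le_one_right (norm_nonneg _) ((div_le_one hwn).2 hww)
  have hσ (z : ℂ) (hz : ‖z‖ = 1) :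
      ‖diskValue z (∑ i, b i * a i : RHInfRing)‖ ≤ ‖diskValue z ψ‖ := by
    rw [diskValue_sum_mul b a hz.le]
    refine (norm_dotProduct_le _ _).trans ?_
    rw [mul_comm]
    exact hab z hz
  have hσ₀ : 1 + diskValue z₀ (∑ i, b i * a i : RHInfRing) ≠ 0 := by
    rw [diskValue_sum_mul b a hz₀.le, ha₀, funext hb]
    exact hk₀
  have hk : ∀ z : ℂ, ‖z‖ ≤ 1 → 1 + diskValue z (∑ i, b i * a i : RHInfRing) ≠ 0 := by
    refine fun z hz ↦ one_add_diskValue_ne_zero _ (fun z hz ↦ (hσ z hz).trans (hψ z hz).1)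
      (fun z hz h0 ↦ ?_) hz
    have h1 : ‖diskValue z ψ‖ = 1 := by
      refine (hψ z hz).1.antisymm (le_trans ?_ (hσ z hz))
      rw [eq_neg_of_add_eq_zero_right h0, norm_neg, norm_one]
    rcases (hψ z hz).2 h1 with rfl | rfl
    · exact hσ₀ h0
    · refine hσ₀ ?_
      rw [diskValue_conj] at h0
      have := congrArg (starRingEnd ℂ) h0
      simpa using this
  obtain ⟨Q, hQ, hQval⟩ := exists_rankOneCayley a b hk
  have hQ₀ : Q.map (diskValue z₀) = rankOneCayley w' bv := by
    rw [hQval z₀ hz₀.le, ha₀, funext hb]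
  have hQ₀acc : IsQuasiAccretive (Q.map (diskValue z₀)) := by
    rw [hQ₀]
    exact isQuasiAccretive_rankOneCayley_of_eq hw0 hbv hk₀ hww hwy hwx hxA
  have hhQ : IsStableTM (h • Q) := fun i j ↦ mul_mem_RHInf hh (hQ i j)
  refine ⟨Q, hQ, fun z hz ↦ ?_, fun hstab ↦ ?_⟩
  · rcases (hψ z hz).1.lt_or_eq with hlt | heq
    · rw [hQval z hz.le]
      refine isQuasiAccretive_rankOneCayley_of_lt ?_ ((hab z hz).trans_lt hlt)
      rw [← diskValue_sum_mul b a hz.le]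
      exact hk z hz.le
    · rcases (hψ z hz).2 heq with rfl | rfl
      · exact hQ₀acc
      · have : Q.map (diskValue (starRingEnd ℂ z₀)) =
            (Q.map (diskValue z₀)).map (starRingEnd ℂ) := by
          ext i j
          exact diskValue_conj z₀ _
        rw [this]
        exact hQ₀acc.map_conj
  · refine (feedbackStable_iff hhQ hC).1 hstab z₀ hz₀.le
      (exists_mulVec_eq_zero_iff.1 ⟨y, hy0, ?_⟩)
    have hby : bv ⬝ᵥ y = 1 + bv ⬝ᵥ w' := by rw [← hwy, dotProduct_add, hbw]
    have hQy : Q.map (diskValue z₀) *ᵥ y = -x := by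
      rw [hQ₀, rankOneCayley_mulVec, hby, inv_mul_cancel_right₀ hk₀, ← hwy, ← hwx, two_smul]
      abel
    rw [map_diskValue_smul hQ hh hz₀.le, Matrix.mul_smul, ← Matrix.smul_mul, add_mulVec, one_mulVec,
      ← mulVec_mulVec, hQy, mulVec_neg]
    exact add_neg_cancel y

end PhaseDestabilization

/-! ### The theorem on extended frequencies -/

lemma diskValue_ne_zero_of_isRHInfUnit {f : RatFunc ℝ} (hf : IsRHInfUnit f) {z : ℂ}
    (hz : ‖z‖ ≤ 1) : diskValue z f ≠ 0 := by
  have h1 := diskValue_mul hf.2.1 hf.2.2 hz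
  rw [mul_inv_cancel₀ hf.1] at h1
  have h2 : diskValue z (1 : RatFunc ℝ) = 1 := by simpa using diskValue_C z 1
  exact left_ne_zero_of_mul_eq_one (h1.symm.trans h2)

lemma exp_neg_arg_mul (c : ℂ) :
    Complex.exp (Complex.I * (-c.arg : ℝ)) * c = ‖c‖ := by
  conv_lhs => rw [← Complex.norm_mul_exp_arg_mul_I c]
  rw [mul_left_comm, ← Complex.exp_add]
  simp [mul_comm Complex.I]

theorem mainTheorem3 (n : ℕ) (hn : 1 ≤ n)
    (C : Matrix (Fin n) (Fin n) (RatFunc ℝ)) (hC : IsStableTM C)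
    (hCsec : ∀ ω : EReal, IsSectorial (freqResponse C ω))
    (g h : RatFunc ℝ) (hg : IsRHInfUnit g) (hh : IsRHInfUnit h)
    (hharg : ∀ ω : EReal,
      Complex.arg (freqValue h ω) ∈ Set.Ioo (-(Real.pi / 2)) (Real.pi / 2)) :
    (∀ P : Matrix (Fin n) (Fin n) (RatFunc ℝ), IsStableTM P →
      (∀ ω : EReal, 0 ≤ ω →
        freqResponse P ω ∈
          phaseSetClosed n (-(Real.pi / 2) + Complex.arg (freqValue h ω))
              (Real.pi / 2 + Complex.arg (freqValue h ω)) ∪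
            gainSetClosed n ‖freqValue g ω‖) →
      FeedbackStable P C) ↔
    ∀ ω : EReal, 0 ≤ ω →
      freqResponse C ω ∈
        phaseSetOpen n (-(Real.pi / 2) - Complex.arg (freqValue h ω))
            (Real.pi / 2 - Complex.arg (freqValue h ω)) ∩
          gainSetOpen n ‖freqValue g ω‖⁻¹ := by
  have hresp {G : Matrix (Fin n) (Fin n) (RatFunc ℝ)} (hG : IsStableTM G) {ω : EReal} {z : ℂ}
      (hz : ∀ f ∈ RHInf, freqValue f ω = diskValue z f) :
      freqResponse G ω = G.map (diskValue z) := by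
    ext i j
    exact hz _ (hG i j)
  constructor
  · intro hall ω₀ hω₀
    obtain ⟨z₀, hz₀, hval₀⟩ := exists_circle_point ω₀
    constructor
    · by_contra hphase
      rw [mem_phaseSetOpen_iff hn (hharg ω₀)] at hphase
      push Not at hphase
      obtain ⟨x, hx, hxre⟩ := hphase
      rw [hval₀ h hh.2.1, hresp hC hval₀] at hxre
      obtain ⟨Q, hQ, hQacc, hQC⟩ := exists_destabilizing_of_phase hC hh.2.1 hz₀
        (diskValue_ne_zero_of_isRHInfUnit hh hz₀.le)
        (by rw [← hresp hC hval₀]; exact isSectorial_iff.1 (hCsec ω₀)) hx (by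
          rw [← Complex.norm_mul_exp_arg_mul_I (diskValue z₀ h), mul_assoc, Complex.re_ofReal_mul,
            mul_comm _ Complex.I]
          exact mul_nonpos_of_nonneg_of_nonpos (norm_nonneg _) hxre)
      have hhQ : IsStableTM (h • Q) := fun i j ↦ mul_mem_RHInf hh.2.1 (hQ i j)
      refine hQC (hall _ hhQ fun ω _ ↦ Or.inl ?_)
      obtain ⟨z, hz, hval⟩ := exists_circle_point ω
      obtain ⟨ε, hε, h0, h1⟩ := hQacc z hz
      have hpos : 0 < ‖diskValue z h‖ :=
        norm_pos_iff.2 (diskValue_ne_zero_of_isRHInfUnit hh hz.le)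
      -- Undoing the phase of `h` turns the form of `h Q` into `|h| > 0` times that of `Q`, so
      -- quasi-accretivity of `Q` is the phase bound centered at the argument of `h`.
      have hrot (x : Fin n → ℂ) :
          Complex.exp (Complex.I * (-(freqValue h ω).arg : ℝ)) *
            (star x ⬝ᵥ (freqResponse (h • Q) ω *ᵥ x)) =
          (‖diskValue z h‖ : ℂ) * (star x ⬝ᵥ (Q.map (diskValue z) *ᵥ x)) := by
        rw [hresp hhQ hval, map_diskValue_smul hQ hh.2.1 hz.le, Matrix.smul_mulVec,
          dotProduct_smul, smul_eq_mul, ← mul_assoc, hval h hh.2.1, exp_neg_arg_mul]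
      refine mem_phaseSetClosed_of_form hn (hharg ω) hε (fun x ↦ ?_) fun x hx hre ↦ ?_
      · rw [hrot, Complex.re_ofReal_mul]
        exact mul_nonneg hpos.le (h0 x)
      · rw [hrot, Complex.re_ofReal_mul, mul_eq_zero] at hre
        rw [hrot, Complex.im_ofReal_mul, mul_left_comm]
        exact mul_pos hpos (h1 x hx (hre.resolve_left hpos.ne'))
    · by_contra hgain
      obtain ⟨P, hP, hPg, hPC⟩ := exists_destabilizing_of_gain hn hC hg.2.1 hz₀
        (diskValue_ne_zero_of_isRHInfUnit hg hz₀.le) (by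
          rw [← hval₀ g hg.2.1, ← hresp hC hval₀]
          exact not_lt.1 hgain)
      refine hPC (hall P hP fun ω _ ↦ Or.inr ?_)
      obtain ⟨z, hz, hval⟩ := exists_circle_point ω
      rw [hval g hg.2.1, hresp hP hval]
      exact hPg z hz
  · intro hcond P hP hPcond
    exact feedbackStable_of_forall_frequency hP hC fun ω hω τ hτ ↦
      det_one_add_smul_mul_ne_zero hn (hharg ω) (hcond ω hω) (hPcond ω hω) hτ
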